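/- For a permutation $\pi=\pi_1\cdots\pi_n$ of $\{1,\dots,n\}$ let $\mathrm{inv}(\pi)$ be the number of pairs $1\le a<b\le n$ with $\pi_a>\pi_b$, and let $\mathrm{maj}(\pi)$ be the sum of all $k\in\{1,\dots,n-1\}$ with $\pi_k>\pi_{k+1}$. Put $m_n=\frac{n(n-1)}{4}$, $\sigma_n=\sqrt{\frac{2n^3+3n^2-5n}{72}}$, $X_n=\frac{\mathrm{inv}-m_n}{\sigma_n}$ and $Y_n=\frac{\mathrm{maj}-m_n}{\sigma_n}$ (for $n\ge2$). Say that a sequence of pairs $(U_n,V_n)$ of real random variables is *asymptotically joint-independently-normal* if, as $n\to\infty$, (a) $(U_n,V_n)$ converges in distribution to a pair of independent standard normal variables, so that for all real $s,t$ $$\Pr(U_n\le s,\;V_n\le t)\to\frac1{2\pi}\int_{-\infty}^s\int_{-\infty}^t e^{-x^2/2-y^2/2}\,dy\,dx ;$$ (b) all mixed moments converge to those of a pair of independent standard normal variables: for all integers $r,s\ge0$, $$E[U_n^{2r}V_n^{2s}]\to\frac{(2r)!}{2^r r!}\cdot\frac{(2s)!}{2^s s!},$$ and $E[U_n^{2r+1}V_n^{2s}]$,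 $E[U_n^{2r}V_n^{2s+1}]$ and $E[U_n^{2r+1}V_n^{2s+1}]$ all tend to $0$. Then: 1. For $\pi$ uniformly distributed on all permutations of $\{1,\dots,n\}$, the pairs $(X_n,Y_n)$ are asymptotically joint-independently-normal. 2. Let $i_1,i_2,\dots$ be any sequence of integers with $1\le i_n\le n$ (for example $i_n=i$ for all $n\ge i$, with a fixed $i$), and let $\pi$ be uniformly distributed on the $(n-1)!$ permutations of $\{1,\dots,n\}$ with $\pi_n=i_n$. Then the pairs $(X_n,Y_n)$ are asymptotically joint-independently-normal, and so are the pairs obtained from $(\mathrm{inv},\mathrm{maj})$ by centralizing and normalizing each of the two statistics by its own mean and standard deviation on these $(n-1)!$ permutations. -/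

import Mathlib

open MeasureTheory ProbabilityTheory Filter Topology
open scoped Nat

noncomputable section

/-- The number of inversions of `π`: the number of pairs of positions `a < b` with `π a > π b`. -/
def invNumber {n : ℕ} (π : Equiv.Perm (Fin n)) : ℕ :=
  (Finset.univ.filter fun p : Fin n × Fin n => p.1 < p.2 ∧ π p.2 < π p.1).card

/-- The major index of `π`: the sum of the places at which `π` has a descent. The place with
index `k` in `Fin n` is the place `k + 1` in the usual numbering `1, …, n`. -/
def majorIndex {n : ℕ} (π : Equiv.Perm (Fin n)) : ℕ :=
  ∑ k ∈ Finset.univ.filter (fun k : Fin n => ∃ h : (k : ℕ) + 1 < n, π ⟨(k : ℕ) + 1, h⟩ < π k),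
    ((k : ℕ) + 1)

/-- The normalization `m_n = n (n - 1) / 4`. -/
def meanInv (n : ℕ) : ℝ := (n : ℝ) * ((n : ℝ) - 1) / 4

/-- The normalization `σ_n`, where `σ_n ^ 2 = (2 n ^ 3 + 3 n ^ 2 - 5 n) / 72`. -/
def sigmaInv (n : ℕ) : ℝ := Real.sqrt ((2 * (n : ℝ) ^ 3 + 3 * (n : ℝ) ^ 2 - 5 * (n : ℝ)) / 72)

/-- `X_n`. -/
def normInv (n : ℕ) (π : Equiv.Perm (Fin n)) : ℝ := ((invNumber π : ℝ) - meanInv n) / sigmaInv n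

/-- `Y_n`. -/
def normMaj (n : ℕ) (π : Equiv.Perm (Fin n)) : ℝ := ((majorIndex π : ℝ) - meanInv n) / sigmaInv n

/-- Every set of permutations is an event. -/
instance permMeasurableSpace (n : ℕ) : MeasurableSpace (Equiv.Perm (Fin n)) := ⊤

instance permDiscreteMeasurableSpace (n : ℕ) : DiscreteMeasurableSpace (Equiv.Perm (Fin n)) :=
  ⟨fun _ => trivial⟩

/-- The uniform distribution on all permutations of `{1, …, n}`. -/
def unifPerm (n : ℕ) : Measure (Equiv.Perm (Fin n)) := uniformOn Set.univ

instance unifPerm_isProbabilityMeasure (n : ℕ) : IsProbabilityMeasure (unifPerm n) :=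
  isProbabilityMeasure_uniformOn Set.finite_univ Set.univ_nonempty

/-- The uniform distribution on those permutations of `{1, …, n + 1}` whose last entry is `i`
(the element `i` of `Fin (n + 1)` is the entry `i + 1` in the usual numbering). -/
def unifPermEnding (n : ℕ) (i : Fin (n + 1)) : Measure (Equiv.Perm (Fin (n + 1))) :=
  uniformOn {π | π (Fin.last n) = i}

instance unifPermEnding_isProbabilityMeasure (n : ℕ) (i : Fin (n + 1)) :
    IsProbabilityMeasure (unifPermEnding n i) :=
  isProbabilityMeasure_uniformOn (Set.toFinite _)
    ⟨Equiv.swap (Fin.last n) i, Equiv.swap_apply_left _ _⟩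

/-- The random variable `f`, centralized and normalized by its own mean and standard deviation
under `P`. -/
def standardize {Ω : Type} [MeasurableSpace Ω] (P : Measure Ω) (f : Ω → ℝ) (ω : Ω) : ℝ :=
  (f ω - ∫ ω', f ω' ∂P) / Real.sqrt (variance f P)

/-- The pairs `(X n, Y n)` of random variables, on the probability spaces `(Ω n, P n)`, are
asymptotically joint-independently-normal, in distribution and with all mixed moments. -/
structure AsympJointIndepNormal {Ω : ℕ → Type} [∀ n, MeasurableSpace (Ω n)]
    (P : ∀ n, Measure (Ω n)) [∀ n, IsProbabilityMeasure (P n)] (X Y : ∀ n, Ω n → ℝ) : Prop where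
  /-- Convergence in distribution to a pair of independent standard normal variables. -/
  inDistribution : TendstoInDistribution (fun n ω => (X n ω, Y n ω)) atTop
    (id : ℝ × ℝ → ℝ × ℝ) P ((gaussianReal 0 1).prod (gaussianReal 0 1))
  /-- Convergence of the joint cumulative distribution functions. -/
  cdf : ∀ s t : ℝ, Tendsto (fun n => (P n).real {ω | X n ω ≤ s ∧ Y n ω ≤ t}) atTop
    (𝓝 (1 / (2 * Real.pi) *
      ∫ x in Set.Iic s, ∫ y in Set.Iic t, Real.exp (-x ^ 2 / 2 - y ^ 2 / 2)))
  /-- Convergence of the mixed moments to those of a pair of independent standard normals. -/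
  moment_even_even : ∀ r s : ℕ,
    Tendsto (fun n => ∫ ω, X n ω ^ (2 * r) * Y n ω ^ (2 * s) ∂(P n)) atTop
      (𝓝 (((2 * r)! : ℝ) / (2 ^ r * (r ! : ℝ)) * (((2 * s)! : ℝ) / (2 ^ s * (s ! : ℝ)))))
  moment_odd_even : ∀ r s : ℕ,
    Tendsto (fun n => ∫ ω, X n ω ^ (2 * r + 1) * Y n ω ^ (2 * s) ∂(P n)) atTop (𝓝 0)
  moment_even_odd : ∀ r s : ℕ,
    Tendsto (fun n => ∫ ω, X n ω ^ (2 * r) * Y n ω ^ (2 * s + 1) ∂(P n)) atTop (𝓝 0)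
  moment_odd_odd : ∀ r s : ℕ,
    Tendsto (fun n => ∫ ω, X n ω ^ (2 * r + 1) * Y n ω ^ (2 * s + 1) ∂(P n)) atTop (𝓝 0)

end

/-! Number positions from 0 and let d_k count the larger entries to the left of position k. For a
uniform permutation these digits are independent, d_k being uniform on {0, …, k}. Then inv is the
sum of the d_k, and there is a descent between positions k-1 and k exactly when d_{k-1} < d_k, so
maj = ∑ k·1[d_{k-1} < d_k].

After centering, s·inv + t·maj is therefore a sum of bounded terms, each depending on two adjacent
independent digits. Its variance is exactly (s² + t²)σ_n² + st·n(n-1)/4: the covariance of inv and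
maj is only of order n², against σ_n² of order n³, which is why the limits are independent. Each
normalized term is O(n^{-1/2}), so Stein's method for locally dependent sums gives the recursion E
W^{j+2} ≈ (j+1)·Var(W)·E W^j, that is, Gaussian moments for every linear combination
(`tendsto_moments_of_local_dependence`, `LehmerCode.integral_sum_summand_sq`).

Mixed moments are read off as coefficients of polynomials in s
(`mixedMomentsConverge_of_linear_combination`). They determine the limits of the characteristic
functions, hence convergence in distribution and of the joint distribution functions
(`MixedMomentsConverge.asympJointIndepNormal`).

Prescribing the last entry fixes only the last digit and leaves the others independent and uniform.
The last digit changes either statistic by at most its index, which is negligible on the scale σ_n;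
standardizing by the true mean and deviation is negligible too. Both cases follow from
`MixedMomentsConverge.of_perturbation`. -/

noncomputable section

/-! ### Gaussian moments -/

/-- The moments of the standard normal distribution. -/
def gaussMoment : ℕ → ℝ
  | 0 => 1
  | 1 => 0
  | k + 2 => (k + 1) * gaussMoment k

lemma gaussMoment_odd (r : ℕ) : gaussMoment (2 * r + 1) = 0 := by
  induction r with
  | zero => rfl
  | succ r ih =>
    rw [show 2 * (r + 1) + 1 = (2 * r + 1) + 2 by ring, gaussMoment, ih, mul_zero]

lemma gaussMoment_even (r : ℕ) :
    gaussMoment (2 * r) = ((2 * r)! : ℝ) / (2 ^ r * (r ! : ℝ)) := by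
  induction r with
  | zero => simp [gaussMoment]
  | succ r ih =>
    rw [show 2 * (r + 1) = 2 * r + 2 by ring, gaussMoment, ih, Nat.factorial_succ (2 * r + 1),
      Nat.factorial_succ (2 * r), Nat.factorial_succ r]
    push_cast
    field_simp
    ring

lemma gaussMoment_of_odd {m : ℕ} (h : Odd m) : gaussMoment m = 0 := by
  obtain ⟨r, rfl⟩ := h
  exact gaussMoment_odd r

lemma sum_range_two_mul_add_one {M : Type*} [AddCommMonoid M] (f : ℕ → M)
    (hf : ∀ i, f (2 * i + 1) = 0) (N : ℕ) :
    ∑ j ∈ Finset.range (2 * N + 1), f j = ∑ i ∈ Finset.range (N + 1), f (2 * i) := by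
  induction N with
  | zero => simp
  | succ N ih =>
    rw [show 2 * (N + 1) + 1 = (2 * N + 1) + 1 + 1 by ring, Finset.sum_range_succ,
      Finset.sum_range_succ, ih, hf, add_zero, Finset.sum_range_succ _ (N + 1)]
    rfl

/-- This is the m-th moment of sG + tG' for independent standard normals G, G', which is normal of
variance s² + t². For even m only even j survive and the sum is a binomial expansion; for odd m one
of j, m - j is always odd. -/
lemma sum_choose_mul_gaussMoment (s t : ℝ) (m : ℕ) :
    ∑ j ∈ Finset.range (m + 1),
        s ^ j * t ^ (m - j) * (m.choose j : ℝ) * (gaussMoment j * gaussMoment (m - j)) =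
      (s ^ 2 + t ^ 2) ^ (m / 2) * gaussMoment m := by
  rcases Nat.even_or_odd' m with ⟨N, rfl | rfl⟩
  · rw [sum_range_two_mul_add_one, Nat.mul_div_cancel_left _ two_pos, add_pow, Finset.sum_mul]
    · refine Finset.sum_congr rfl fun i hi => ?_
      obtain ⟨k, rfl⟩ : ∃ k, N = i + k := Nat.exists_eq_add_of_le (by simpa [Nat.lt_succ_iff] using hi)
      rw [show 2 * (i + k) - 2 * i = 2 * k by omega, show i + k - i = k by omega,
        gaussMoment_even, gaussMoment_even, gaussMoment_even,
        show 2 * (i + k) = 2 * i + 2 * k by ring, Nat.cast_add_choose, Nat.cast_add_choose]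
      field_simp
      ring
    · intro i
      simp [gaussMoment_odd]
  · rw [gaussMoment_odd, mul_zero]
    refine Finset.sum_eq_zero fun j hj => ?_
    have hj' : j ≤ 2 * N + 1 := by simpa [Nat.lt_succ_iff] using hj
    rcases Nat.even_or_odd j with h | h
    · rw [gaussMoment_of_odd (m := 2 * N + 1 - j), mul_zero, mul_zero]
      rw [Nat.odd_sub hj']
      simp [h]
    · rw [gaussMoment_of_odd h, zero_mul, mul_zero]

/-! ### From moments to characteristic functions -/

/-- The derivative of the remainder of order N + 1 is z times the remainder of order N, so the bound
integrates up by induction. A general unit z on the imaginary axis lets z = -i cover negative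
arguments. -/
lemma norm_cexp_mul_sub_sum_le (z : ℂ) (hz : ‖z‖ = 1) (hre : z.re = 0) (N : ℕ) :
    ∀ x : ℝ, 0 ≤ x →
      ‖Complex.exp (x * z) - ∑ j ∈ Finset.range N, (x * z) ^ j / (j ! : ℂ)‖ ≤ x ^ N / N ! := by
  induction N with
  | zero =>
    intro x _
    simp [Complex.norm_exp, hre]
  | succ N ih =>
    intro x hx
    have hder : ∀ y : ℝ, HasDerivAt
        (fun y : ℝ => Complex.exp (y * z) - ∑ j ∈ Finset.range (N + 1), (y * z) ^ j / (j ! : ℂ))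
        ((Complex.exp (y * z) - ∑ j ∈ Finset.range N, (y * z) ^ j / (j ! : ℂ)) * z) y := by
      intro y
      have h1 : HasDerivAt (fun y : ℝ => (y : ℂ) * z) z y := by
        simpa using (Complex.ofRealCLM.hasDerivAt (x := y)).mul_const z
      have h2 : HasDerivAt
          (fun y : ℝ => ∑ j ∈ Finset.range (N + 1), ((y : ℂ) * z) ^ j / (j ! : ℂ))
          (∑ j ∈ Finset.range (N + 1), ((j : ℂ) * ((y : ℂ) * z) ^ (j - 1) * z) / (j ! : ℂ)) y :=
        HasDerivAt.fun_sum fun j _ => (h1.pow j).div_const _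
      refine (h1.cexp.sub h2).congr_deriv ?_
      rw [sub_mul, Finset.sum_range_succ']
      simp only [Nat.cast_zero, zero_mul, zero_div, add_zero, Finset.sum_mul]
      congr 1
      refine Finset.sum_congr rfl fun j _ => ?_
      rw [Nat.factorial_succ]
      have : ((j : ℂ) + 1) ≠ 0 := by exact_mod_cast Nat.succ_ne_zero j
      push_cast
      field_simp
    refine image_norm_le_of_norm_deriv_right_le_deriv_boundary (a := 0) (b := x)
      (B := fun y => y ^ (N + 1) / (N + 1)!) (B' := fun y => y ^ N / N !)
      (fun y _ => (hder y).continuousAt.continuousWithinAt)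
      (fun y _ => (hder y).hasDerivWithinAt) ?_ ?_ ?_ ⟨hx, le_rfl⟩
    · rw [Finset.sum_range_succ']
      simp
    · intro y
      refine ((hasDerivAt_pow (N + 1) y).div_const _).congr_deriv ?_
      rw [Nat.factorial_succ]
      push_cast
      field_simp
    · intro y hy
      rw [norm_mul, hz, mul_one]
      exact ih y hy.1

lemma norm_cexp_mul_I_sub_sum_le (x : ℝ) (N : ℕ) :
    ‖Complex.exp (x * Complex.I) - ∑ j ∈ Finset.range N, (x * Complex.I) ^ j / (j ! : ℂ)‖ ≤
      |x| ^ N / N ! := by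
  rcases le_total 0 x with h | h
  · simpa [abs_of_nonneg h] using norm_cexp_mul_sub_sum_le Complex.I (by simp) (by simp) N x h
  · simpa [abs_of_nonpos h] using
      norm_cexp_mul_sub_sum_le (-Complex.I) (by simp) (by simp) N (-x) (by linarith)

/-- Interchange of limits: the truncation level N is chosen first, then n. -/
lemma tendsto_of_forall_norm_sub_le {E : Type*} [NormedAddCommGroup E] {a : ℕ → E}
    {b : ℕ → ℕ → E} {c : ℕ → ℕ → ℝ} {B : ℕ → E} {C : ℕ → ℝ} {L : E}
    (h : ∀ N n, ‖a n - b N n‖ ≤ c N n) (hb : ∀ N, Tendsto (b N) atTop (𝓝 (B N)))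
    (hc : ∀ N, Tendsto (c N) atTop (𝓝 (C N))) (hB : Tendsto B atTop (𝓝 L))
    (hC : Tendsto C atTop (𝓝 0)) : Tendsto a atTop (𝓝 L) := by
  rw [Metric.tendsto_atTop']
  intro ε hε
  have h4 : 0 < ε / 4 := by positivity
  obtain ⟨N, hN1, hN2⟩ := ((hB.eventually (Metric.ball_mem_nhds L h4)).and
    (hC.eventually (Metric.ball_mem_nhds 0 h4))).exists
  obtain ⟨n₀, hn⟩ := eventually_atTop.1 (((hb N).eventually (Metric.ball_mem_nhds _ h4)).and
    ((hc N).eventually (Metric.ball_mem_nhds _ h4)))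
  refine ⟨n₀, fun n hn' => ?_⟩
  obtain ⟨h1, h2⟩ := hn n hn'.le
  rw [Real.dist_eq, abs_lt] at h2 hN2
  have h3 : dist (a n) (b N n) ≤ c N n := by rw [dist_eq_norm]; exact h N n
  have h5 := dist_triangle4 (a n) (b N n) (B N) L
  linarith [h2.2, hN2.2]

lemma tendsto_integral_cexp_of_tendsto_moments {Ω : ℕ → Type} [∀ n, MeasurableSpace (Ω n)]
    [∀ n, Finite (Ω n)] [∀ n, DiscreteMeasurableSpace (Ω n)] (P : ∀ n, Measure (Ω n))
    [∀ n, IsProbabilityMeasure (P n)] (W : ∀ n, Ω n → ℝ) (v : ℝ)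
    (h : ∀ m : ℕ, Tendsto (fun n => ∫ ω, W n ω ^ m ∂(P n)) atTop
      (𝓝 (v ^ (m / 2) * gaussMoment m))) :
    Tendsto (fun n => ∫ ω, Complex.exp (W n ω * Complex.I) ∂(P n)) atTop
      (𝓝 (Complex.exp (-v / 2))) := by
  refine tendsto_of_forall_norm_sub_le
    (b := fun N n => ∑ j ∈ Finset.range (2 * N + 1),
      ((∫ ω, W n ω ^ j ∂(P n) : ℝ) : ℂ) * (Complex.I ^ j / (j ! : ℂ)))
    (c := fun N n => (∫ ω, W n ω ^ (2 * N) ∂(P n)) * (1 / (2 * N)!) +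
      (∫ ω, W n ω ^ (2 * N) ∂(P n)) * (1 / (2 * N)!))
    (B := fun N => ∑ j ∈ Finset.range (2 * N + 1),
      ((v ^ (j / 2) * gaussMoment j : ℝ) : ℂ) * (Complex.I ^ j / (j ! : ℂ)))
    (C := fun N => (v ^ N * gaussMoment (2 * N)) * (1 / (2 * N)!) +
      (v ^ N * gaussMoment (2 * N)) * (1 / (2 * N)!)) ?_ ?_ ?_ ?_ ?_
  · intro N n
    have hpos : 0 ≤ ∫ ω, W n ω ^ (2 * N) ∂(P n) :=
      integral_nonneg fun ω => (even_two_mul N).pow_nonneg _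
    -- Truncating before an even degree makes the Taylor error an actual moment, E W^{2N}/(2N)!. The
    -- term of degree 2N, split off here, has the same norm, hence the two equal summands of `c`.
    rw [Finset.sum_range_succ, ← sub_sub]
    refine (norm_sub_le _ _).trans (add_le_add ?_ (le_of_eq ?_))
    · have : ∑ j ∈ Finset.range (2 * N),
          ((∫ ω, W n ω ^ j ∂(P n) : ℝ) : ℂ) * (Complex.I ^ j / (j ! : ℂ)) =
          ∫ ω, ∑ j ∈ Finset.range (2 * N), (W n ω * Complex.I) ^ j / (j ! : ℂ) ∂(P n) := by
        rw [integral_finsetSum _ fun _ _ => Integrable.of_finite]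
        refine Finset.sum_congr rfl fun j _ => ?_
        rw [← integral_complex_ofReal, ← integral_mul_const]
        refine integral_congr_ae (ae_of_all _ fun ω => ?_)
        push_cast
        ring
      rw [this, ← integral_sub Integrable.of_finite Integrable.of_finite, ← integral_mul_const]
      refine (norm_integral_le_integral_norm _).trans
        (integral_mono Integrable.of_finite Integrable.of_finite fun ω => ?_)
      refine (norm_cexp_mul_I_sub_sum_le _ _).trans (le_of_eq ?_)
      rw [(even_two_mul N).pow_abs, div_eq_mul_one_div]
    · rw [norm_mul, Complex.norm_real, Real.norm_of_nonneg hpos]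
      simp
  · intro N
    refine tendsto_finsetSum _ fun j _ => Tendsto.mul_const _ ?_
    exact (Complex.continuous_ofReal.tendsto _).comp (h j)
  · intro N
    have := h (2 * N)
    rw [Nat.mul_div_cancel_left _ two_pos] at this
    exact (this.mul_const _).add (this.mul_const _)
  -- Since the moment of order 2i over (2i)! is (v/2)^i / i!, the limiting sums are partial sums of
  -- exp(-v/2).
  · have hB : ∀ N, ∑ j ∈ Finset.range (2 * N + 1),
        ((v ^ (j / 2) * gaussMoment j : ℝ) : ℂ) * (Complex.I ^ j / (j ! : ℂ)) =
        ∑ i ∈ Finset.range (N + 1), (-v / 2 : ℂ) ^ i / (i ! : ℂ) := by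
      intro N
      rw [sum_range_two_mul_add_one _ (by simp [gaussMoment_odd])]
      refine Finset.sum_congr rfl fun i _ => ?_
      rw [gaussMoment_even, Nat.mul_div_cancel_left _ two_pos, pow_mul, Complex.I_sq]
      have h1 : ((2 * i)! : ℂ) ≠ 0 := by exact_mod_cast Nat.factorial_ne_zero _
      have h2 : (i ! : ℂ) ≠ 0 := by exact_mod_cast Nat.factorial_ne_zero _
      push_cast
      rw [neg_div, neg_pow (v / 2 : ℂ), div_pow]
      field_simp
    simp_rw [hB]
    have := (NormedSpace.expSeries_div_hasSum_exp (-v / 2 : ℂ)).tendsto_sum_nat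
    rw [← Complex.exp_eq_exp_ℂ] at this
    exact this.comp (tendsto_add_atTop_nat 1)
  · have hC : ∀ N, (v ^ N * gaussMoment (2 * N)) * (1 / ((2 * N)! : ℝ)) = (v / 2) ^ N / N ! := by
      intro N
      rw [gaussMoment_even, div_pow]
      field_simp
    simp_rw [hC]
    simpa using (FloorSemiring.tendsto_pow_div_factorial_atTop (v / 2)).add
      (FloorSemiring.tendsto_pow_div_factorial_atTop (v / 2))

/-! ### Mixed moments, linear combinations and convergence in distribution -/

/-- All mixed moments of the pairs `(X n, Y n)` converge to those of a pair of independent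
standard normal variables. -/
def MixedMomentsConverge {Ω : ℕ → Type} [∀ n, MeasurableSpace (Ω n)]
    (P : ∀ n, Measure (Ω n)) (X Y : ∀ n, Ω n → ℝ) : Prop :=
  ∀ a b : ℕ, Tendsto (fun n => ∫ ω, X n ω ^ a * Y n ω ^ b ∂(P n)) atTop
    (𝓝 (gaussMoment a * gaussMoment b))

/-- By Lagrange interpolation, each coefficient of a polynomial of degree at most m is a fixed
linear combination of its values at 0, …, m. -/
lemma tendsto_coeff_of_tendsto_eval {a : ℕ → ℕ → ℝ} {b : ℕ → ℝ} {m : ℕ}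
    (h : ∀ s : ℝ, Tendsto (fun n => ∑ j ∈ Finset.range (m + 1), a n j * s ^ j) atTop
      (𝓝 (∑ j ∈ Finset.range (m + 1), b j * s ^ j))) {j : ℕ} (hj : j ≤ m) :
    Tendsto (fun n => a n j) atTop (𝓝 (b j)) := by
  have key : ∀ c : ℕ → ℝ, c j = ∑ i ∈ Finset.range (m + 1),
      (∑ k ∈ Finset.range (m + 1), c k * (i : ℝ) ^ k) *
        (Lagrange.basis (Finset.range (m + 1)) (fun i : ℕ => (i : ℝ)) i).coeff j := by
    intro c
    set p : Polynomial ℝ :=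
      ∑ k ∈ Finset.range (m + 1), Polynomial.C (c k) * Polynomial.X ^ k with hp
    have hdeg : p.degree < (Finset.range (m + 1)).card := by
      rw [Finset.card_range]
      refine (Polynomial.degree_sum_le _ _).trans_lt
        ((Finset.sup_lt_iff (WithBot.bot_lt_coe _)).2 fun k hk => ?_)
      refine (Polynomial.degree_C_mul_X_pow_le k _).trans_lt ?_
      exact_mod_cast Finset.mem_range.1 hk
    have h1 := Lagrange.eq_interpolate (s := Finset.range (m + 1)) (v := fun i : ℕ => (i : ℝ))
      (Nat.cast_injective.injOn) hdeg
    have h2 : p.coeff j = c j := by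
      simp [hp, Polynomial.coeff_X_pow, hj]
    rw [← h2, h1, Lagrange.interpolate_apply, Polynomial.finsetSum_coeff]
    refine Finset.sum_congr rfl fun i _ => ?_
    rw [Polynomial.coeff_C_mul]
    simp [hp, Polynomial.eval_finsetSum]
  rw [key b]
  simp_rw [key (a _)]
  exact tendsto_finsetSum _ fun i _ => (h i).mul_const _

section

variable {Ω : ℕ → Type} [∀ n, MeasurableSpace (Ω n)] [∀ n, Finite (Ω n)]
  [∀ n, DiscreteMeasurableSpace (Ω n)] {P : ∀ n, Measure (Ω n)} [∀ n, IsProbabilityMeasure (P n)]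
  {X Y : ∀ n, Ω n → ℝ}

lemma integral_linear_combination_pow (s t : ℝ) (m n : ℕ) :
    ∫ ω, (s * X n ω + t * Y n ω) ^ m ∂(P n) = ∑ j ∈ Finset.range (m + 1),
      s ^ j * t ^ (m - j) * (m.choose j : ℝ) * ∫ ω, X n ω ^ j * Y n ω ^ (m - j) ∂(P n) := by
  simp_rw [add_pow]
  rw [integral_finsetSum _ fun _ _ => Integrable.of_finite]
  refine Finset.sum_congr rfl fun j _ => ?_
  rw [← integral_const_mul]
  refine integral_congr_ae (ae_of_all _ fun ω => ?_)
  ring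

/-- A Cramér–Wold device for moments: with t = 1, the moment of order a + b is a polynomial in s
whose coefficient at s^a is a binomial coefficient times the mixed moment (a, b). -/
lemma mixedMomentsConverge_of_linear_combination
    (h : ∀ (s t : ℝ) (m : ℕ), Tendsto (fun n => ∫ ω, (s * X n ω + t * Y n ω) ^ m ∂(P n)) atTop
      (𝓝 ((s ^ 2 + t ^ 2) ^ (m / 2) * gaussMoment m))) :
    MixedMomentsConverge P X Y := by
  intro a b
  have h1 := tendsto_coeff_of_tendsto_eval (m := a + b)
    (a := fun n j => ((a + b).choose j : ℝ) * ∫ ω, X n ω ^ j * Y n ω ^ (a + b - j) ∂(P n))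
    (b := fun j => ((a + b).choose j : ℝ) * (gaussMoment j * gaussMoment (a + b - j)))
    (fun s => by
      convert h s 1 (a + b) using 2
      · rw [integral_linear_combination_pow]
        exact Finset.sum_congr rfl fun j _ => by ring
      · rw [← sum_choose_mul_gaussMoment]
        exact Finset.sum_congr rfl fun j _ => by ring) (Nat.le_add_right a b)
  have hne : ((a + b).choose a : ℝ) ≠ 0 := by
    exact_mod_cast (Nat.choose_pos (Nat.le_add_right a b)).ne'
  have h2 := h1.const_mul (((a + b).choose a : ℝ)⁻¹)
  simpa only [inv_mul_cancel_left₀ hne, Nat.add_sub_cancel_left] using h2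

lemma MixedMomentsConverge.linear_combination (h : MixedMomentsConverge P X Y) (s t : ℝ) (m : ℕ) :
    Tendsto (fun n => ∫ ω, (s * X n ω + t * Y n ω) ^ m ∂(P n)) atTop
      (𝓝 ((s ^ 2 + t ^ 2) ^ (m / 2) * gaussMoment m)) := by
  simp_rw [integral_linear_combination_pow, ← sum_choose_mul_gaussMoment]
  exact tendsto_finsetSum _ fun j _ => (h _ _).const_mul _

lemma MixedMomentsConverge.tendstoInDistribution (h : MixedMomentsConverge P X Y) :
    TendstoInDistribution (fun n ω => (X n ω, Y n ω)) atTop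
      (id : ℝ × ℝ → ℝ × ℝ) P ((gaussianReal 0 1).prod (gaussianReal 0 1)) := by
  -- Lévy's continuity theorem needs an inner product, so the pairs are first viewed in the
  -- Euclidean plane; continuity of the identification brings the result back.
  have key : TendstoInDistribution (fun n ω => WithLp.toLp 2 (X n ω, Y n ω)) atTop
      (fun p : ℝ × ℝ => WithLp.toLp 2 p) P ((gaussianReal 0 1).prod (gaussianReal 0 1)) := by
    refine ⟨fun n => (Measurable.of_discrete).aemeasurable, by fun_prop, ?_⟩
    refine ProbabilityMeasure.tendsto_iff_tendsto_charFun.2 fun z => ?_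
    simp only [ProbabilityMeasure.coe_mk]
    rw [charFun_prod, charFun_gaussianReal, charFun_gaussianReal, ← Complex.exp_add]
    have h1 := tendsto_integral_cexp_of_tendsto_moments P
      (fun n ω => z.ofLp.1 * X n ω + z.ofLp.2 * Y n ω) _ (h.linear_combination z.ofLp.1 z.ofLp.2)
    convert h1 using 2
    · rw [charFun_apply, integral_map (Measurable.of_discrete).aemeasurable
        (by fun_prop)]
      simp [WithLp.prod_inner_apply]
    · push_cast
      congr 1
      simp
      ring
  exact key.continuous_comp (g := WithLp.ofLp) (by fun_prop)

lemma gaussianReal_zero_one_real (s : Set ℝ) :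
    (gaussianReal 0 1).real s =
      (Real.sqrt (2 * Real.pi))⁻¹ * ∫ x in s, Real.exp (-x ^ 2 / 2) := by
  rw [measureReal_def, gaussianReal_apply_eq_integral 0 one_ne_zero, ENNReal.toReal_ofReal
    (integral_nonneg fun x => gaussianPDFReal_nonneg _ _ _), ← integral_const_mul]
  simp [gaussianPDFReal]

lemma MixedMomentsConverge.tendsto_cdf (h : MixedMomentsConverge P X Y) (s t : ℝ) :
    Tendsto (fun n => (P n).real {ω | X n ω ≤ s ∧ Y n ω ≤ t}) atTop
      (𝓝 (1 / (2 * Real.pi) *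
        ∫ x in Set.Iic s, ∫ y in Set.Iic t, Real.exp (-x ^ 2 / 2 - y ^ 2 / 2))) := by
  have hd := h.tendstoInDistribution
  have h0 : ∀ x : ℝ, gaussianReal 0 1 {x} = 0 :=
    (nullSingletonClass_gaussianReal one_ne_zero).measure_singleton
  -- The boundary of the quadrant lies in two lines, null because the Gaussian has no atoms.
  have hfr : ((gaussianReal 0 1).prod (gaussianReal 0 1)).map (id : ℝ × ℝ → ℝ × ℝ)
      (frontier (Set.Iic s ×ˢ Set.Iic t)) = 0 := by
    rw [Measure.map_id, frontier_prod_eq]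
    refine measure_union_null ?_ ?_
    · simp [Measure.prod_prod, h0]
    · simp [Measure.prod_prod, h0]
  have h1 := ProbabilityMeasure.tendsto_measure_of_null_frontier_of_tendsto' hd.tendsto hfr
  simp only [ProbabilityMeasure.coe_mk, Measure.map_id] at h1
  have h2 := (ENNReal.tendsto_toReal (measure_ne_top _ _)).comp h1
  convert h2 using 2
  · rw [Function.comp_apply, Measure.map_apply Measurable.of_discrete
      (measurableSet_Iic.prod measurableSet_Iic)]
    rfl
  · rw [Measure.prod_prod, ENNReal.toReal_mul,
      ← measureReal_def, ← measureReal_def, gaussianReal_zero_one_real,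
      gaussianReal_zero_one_real]
    have h3 : ∀ x : ℝ, ∫ y in Set.Iic t, Real.exp (-x ^ 2 / 2 - y ^ 2 / 2) =
        Real.exp (-x ^ 2 / 2) * ∫ y in Set.Iic t, Real.exp (-y ^ 2 / 2) := by
      intro x
      rw [← integral_const_mul]
      refine integral_congr_ae (ae_of_all _ fun y => ?_)
      simp only
      rw [← Real.exp_add]
      congr 1
      ring
    simp_rw [h3]
    rw [integral_mul_const]
    have h4 : (Real.sqrt (2 * Real.pi))⁻¹ * (Real.sqrt (2 * Real.pi))⁻¹ = 1 / (2 * Real.pi) := by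
      rw [← mul_inv, Real.mul_self_sqrt (by positivity), one_div]
    rw [← h4]
    ring

theorem MixedMomentsConverge.asympJointIndepNormal (h : MixedMomentsConverge P X Y) :
    AsympJointIndepNormal P X Y where
  inDistribution := h.tendstoInDistribution
  cdf := h.tendsto_cdf
  moment_even_even r s := by simpa [gaussMoment_even] using h (2 * r) (2 * s)
  moment_odd_even r s := by simpa [gaussMoment_odd] using h (2 * r + 1) (2 * s)
  moment_even_odd r s := by simpa [gaussMoment_odd] using h (2 * r) (2 * s + 1)
  moment_odd_odd r s := by simpa [gaussMoment_odd] using h (2 * r + 1) (2 * s + 1)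

end

/-! ### Stability of mixed moments under small perturbations -/

lemma abs_pow_sub_pow_le_of_abs_sub_le {x x' ε M : ℝ} (hε : 0 ≤ ε) (hε1 : ε ≤ 1) (hM : 0 ≤ M)
    (hx : |x| ≤ M) (h : |x' - x| ≤ ε * M) (a : ℕ) :
    |x' ^ a - x ^ a| ≤ ε * (a * 2 ^ a * M ^ a) := by
  have hx' : |x'| ≤ 2 * M := by
    have h1 := abs_add_le (x' - x) x
    rw [sub_add_cancel] at h1
    nlinarith
  induction a with
  | zero => simp
  | succ a ih =>
    calc |x' ^ (a + 1) - x ^ (a + 1)| = |x' ^ a * (x' - x) + x * (x' ^ a - x ^ a)| := by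
          congr 1; ring
      _ ≤ |x'| ^ a * |x' - x| + |x| * |x' ^ a - x ^ a| := by
          refine (abs_add_le _ _).trans_eq ?_
          rw [abs_mul, abs_mul, abs_pow]
      _ ≤ (2 * M) ^ a * (ε * M) + M * (ε * (a * 2 ^ a * M ^ a)) := by gcongr
      _ = ε * (((a + 1) * 2 ^ a) * M ^ (a + 1)) := by rw [mul_pow]; ring
      _ ≤ ε * (((a + 1 : ℕ) : ℝ) * 2 ^ (a + 1) * M ^ (a + 1)) := by
          push_cast
          gcongr <;> norm_num

lemma abs_pow_mul_pow_sub_le {x x' y y' ε M : ℝ} (hε : 0 ≤ ε) (hε1 : ε ≤ 1) (hM : 0 ≤ M)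
    (hx : |x| ≤ M) (hx' : |x' - x| ≤ ε * M) (hy : |y| ≤ M) (hy' : |y' - y| ≤ ε * M) (a b : ℕ) :
    |x' ^ a * y' ^ b - x ^ a * y ^ b| ≤ ε * ((a + b) * 2 ^ (a + b) * M ^ (a + b)) := by
  have h2 : |x'| ≤ 2 * M := by
    have h1 := abs_add_le (x' - x) x
    rw [sub_add_cancel] at h1
    nlinarith
  have h3 : |y| ≤ 2 * M := by linarith
  calc |x' ^ a * y' ^ b - x ^ a * y ^ b|
      = |x' ^ a * (y' ^ b - y ^ b) + y ^ b * (x' ^ a - x ^ a)| := by congr 1; ring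
    _ ≤ |x'| ^ a * |y' ^ b - y ^ b| + |y| ^ b * |x' ^ a - x ^ a| := by
        refine (abs_add_le _ _).trans_eq ?_
        rw [abs_mul, abs_mul, abs_pow, abs_pow]
    _ ≤ (2 * M) ^ a * (ε * (b * 2 ^ b * M ^ b)) + (2 * M) ^ b * (ε * (a * 2 ^ a * M ^ a)) := by
        gcongr
        · exact abs_pow_sub_pow_le_of_abs_sub_le hε hε1 hM hy hy' b
        · exact abs_pow_sub_pow_le_of_abs_sub_le hε hε1 hM hx hx' a
    _ = ε * ((a + b) * 2 ^ (a + b) * M ^ (a + b)) := by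
        rw [mul_pow, mul_pow, pow_add, pow_add]
        ring

lemma abs_pow_le_one_add (x : ℝ) (k : ℕ) : |x| ^ k ≤ 1 + x ^ (2 * k) := by
  have h : x ^ (2 * k) = (|x| ^ k) ^ 2 := by
    rw [← pow_mul, mul_comm k 2, (even_two_mul k).pow_abs]
  nlinarith [sq_nonneg (|x| ^ k - 1)]

lemma one_add_abs_add_abs_pow_le (x y : ℝ) (k : ℕ) :
    (1 + |x| + |y|) ^ k ≤ 3 ^ k * (3 + x ^ (2 * k) + y ^ (2 * k)) := by
  have hx := abs_pow_le_one_add x k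
  have hy := abs_pow_le_one_add y k
  have h0 : (0 : ℝ) ≤ |x| ^ k := by positivity
  have h0' : (0 : ℝ) ≤ |y| ^ k := by positivity
  have hm : 1 + |x| + |y| ≤ 3 * max 1 (max |x| |y|) := by
    have h1 := le_max_left 1 (max |x| |y|)
    have h2 := (le_max_left |x| |y|).trans (le_max_right 1 (max |x| |y|))
    have h3 := (le_max_right |x| |y|).trans (le_max_right 1 (max |x| |y|))
    linarith
  calc (1 + |x| + |y|) ^ k ≤ (3 * max 1 (max |x| |y|)) ^ k := by gcongr
    _ = 3 ^ k * max 1 (max |x| |y|) ^ k := mul_pow _ _ _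
    _ ≤ 3 ^ k * (1 + |x| ^ k + |y| ^ k) := by
        gcongr
        rcases max_choice 1 (max |x| |y|) with h | h
        · rw [h, one_pow]; linarith
        · rw [h]
          rcases max_choice |x| |y| with h | h <;> rw [h] <;> linarith
    _ ≤ _ := mul_le_mul_of_nonneg_left (by linarith) (by positivity)

/-- A monomial of degree k = a + b changes by at most a constant times ε(1 + |X| + |Y|)^k. The
expectation of the last factor is controlled by the moments of order 2k of X and Y, which converge
and so stay bounded. -/
lemma MixedMomentsConverge.of_perturbation {Ω : ℕ → Type} [∀ n, MeasurableSpace (Ω n)]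
    [∀ n, Finite (Ω n)] [∀ n, DiscreteMeasurableSpace (Ω n)] {P : ∀ n, Measure (Ω n)}
    [∀ n, IsProbabilityMeasure (P n)] {X Y X' Y' : ∀ n, Ω n → ℝ} (h : MixedMomentsConverge P X Y)
    {ε : ℕ → ℝ} (hε0 : ∀ n, 0 ≤ ε n) (hε : Tendsto ε atTop (𝓝 0))
    (hX : ∀ᶠ n in atTop, ∀ ω, |X' n ω - X n ω| ≤ ε n * (1 + |X n ω| + |Y n ω|))
    (hY : ∀ᶠ n in atTop, ∀ ω, |Y' n ω - Y n ω| ≤ ε n * (1 + |X n ω| + |Y n ω|)) :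
    MixedMomentsConverge P X' Y' := by
  intro a b
  set k := a + b with hk
  have hbd : Tendsto (fun n => ε n * (((a + b : ℝ) * 2 ^ k) * (3 ^ k * (3 +
      (∫ ω, X n ω ^ (2 * k) * Y n ω ^ 0 ∂(P n)) + ∫ ω, X n ω ^ 0 * Y n ω ^ (2 * k) ∂(P n)))))
      atTop (𝓝 0) := by
    have h1 := hε.mul ((((tendsto_const_nhds (x := (3 : ℝ))).add (h (2 * k) 0)).add
      (h 0 (2 * k))).const_mul ((3 : ℝ) ^ k) |>.const_mul ((a + b : ℝ) * 2 ^ k))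
    rwa [zero_mul] at h1
  have hdiff : Tendsto (fun n => (∫ ω, X' n ω ^ a * Y' n ω ^ b ∂(P n)) -
      ∫ ω, X n ω ^ a * Y n ω ^ b ∂(P n)) atTop (𝓝 0) := by
    refine squeeze_zero_norm' ?_ hbd
    filter_upwards [hX, hY, hε.eventually (ge_mem_nhds zero_lt_one)] with n h1 h2 h3
    rw [← integral_sub Integrable.of_finite Integrable.of_finite]
    refine (norm_integral_le_integral_norm _).trans ?_
    calc ∫ ω, ‖X' n ω ^ a * Y' n ω ^ b - X n ω ^ a * Y n ω ^ b‖ ∂(P n)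
        ≤ ∫ ω, ε n * (((a + b : ℝ) * 2 ^ k) * (3 ^ k * (3 +
            X n ω ^ (2 * k) * Y n ω ^ 0 + X n ω ^ 0 * Y n ω ^ (2 * k)))) ∂(P n) := by
          refine integral_mono Integrable.of_finite Integrable.of_finite fun ω => ?_
          refine (abs_pow_mul_pow_sub_le (M := 1 + |X n ω| + |Y n ω|) (hε0 n) h3 (by positivity)
            (by linarith [abs_nonneg (Y n ω)]) (h1 ω) (by linarith [abs_nonneg (X n ω)])
            (h2 ω) a b).trans ?_
          rw [pow_zero, pow_zero, mul_one, one_mul]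
          have := hε0 n
          have := one_add_abs_add_abs_pow_le (X n ω) (Y n ω) k
          gcongr
      _ = _ := by
          rw [integral_const_mul, integral_const_mul, integral_const_mul,
            integral_add Integrable.of_finite Integrable.of_finite,
            integral_add Integrable.of_finite Integrable.of_finite]
          simp
  simpa using hdiff.add (h a b)

/-! ### Stein's method for moments of locally dependent sums -/

lemma abs_pow_succ_sub_taylor_le {x a δ : ℝ} (ha : |a| ≤ δ) (hδ : δ ≤ 1) (j : ℕ) :
    |x ^ (j + 1) - (x - a) ^ (j + 1) - (j + 1) * a * (x - a) ^ j| ≤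
      δ ^ 2 * (j ^ 2 * (1 + |x|) ^ j) := by
  have hδ0 : 0 ≤ δ := (abs_nonneg a).trans ha
  have hy : |x - a| ≤ 1 + |x| := (abs_sub x a).trans (by linarith)
  have ha2 : a ^ 2 ≤ δ ^ 2 := by rw [← sq_abs]; gcongr
  induction j with
  | zero => simp
  | succ j ih =>
    have hM : 1 ≤ 1 + |x| := by linarith [abs_nonneg x]
    calc |x ^ (j + 1 + 1) - (x - a) ^ (j + 1 + 1) -
          (((j + 1 : ℕ) : ℝ) + 1) * a * (x - a) ^ (j + 1)|
        = |(j + 1) * a ^ 2 * (x - a) ^ j +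
            x * (x ^ (j + 1) - (x - a) ^ (j + 1) - (j + 1) * a * (x - a) ^ j)| := by
          push_cast
          congr 1
          ring
      _ ≤ (j + 1) * a ^ 2 * |x - a| ^ j +
            |x| * |x ^ (j + 1) - (x - a) ^ (j + 1) - (j + 1) * a * (x - a) ^ j| := by
          refine (abs_add_le _ _).trans_eq ?_
          rw [abs_mul _ ((x - a) ^ j), abs_mul x, abs_pow,
            abs_of_nonneg (a := (j + 1 : ℝ) * a ^ 2) (by positivity)]
      _ ≤ (j + 1) * δ ^ 2 * (1 + |x|) ^ j + (1 + |x|) * (δ ^ 2 * (j ^ 2 * (1 + |x|) ^ j)) := by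
          gcongr
          linarith
      _ ≤ (j + 1) * δ ^ 2 * (1 + |x|) ^ (j + 1) +
            (1 + |x|) * (δ ^ 2 * (j ^ 2 * (1 + |x|) ^ j)) := by
          gcongr (j + 1) * δ ^ 2 * ?_ + _
          exact pow_le_pow_right₀ hM (Nat.le_succ j)
      _ = δ ^ 2 * ((j + 1 + j ^ 2) * (1 + |x|) ^ (j + 1)) := by ring
      _ ≤ _ := by
          push_cast
          gcongr
          have : (0 : ℝ) ≤ j := by positivity
          nlinarith

/-- The exponent 2⌊(j+1)/2⌋ is the least even number ≥ j. It is below j + 2, so the moment of that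
order is already known when the induction reaches order j + 2. -/
lemma one_add_abs_pow_le (x : ℝ) (j : ℕ) :
    (1 + |x|) ^ j ≤ 2 ^ j * (2 + x ^ (2 * ((j + 1) / 2))) := by
  have h1 : |x| ^ j ≤ 1 + x ^ (2 * ((j + 1) / 2)) := by
    rw [← (even_two_mul ((j + 1) / 2)).pow_abs]
    rcases le_total |x| 1 with h | h
    · exact (pow_le_one₀ (abs_nonneg x) h).trans (le_add_of_nonneg_right (by positivity))
    · exact (pow_le_pow_right₀ h (show j ≤ 2 * ((j + 1) / 2) by omega)).trans
        (le_add_of_nonneg_left zero_le_one)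
  have h0 : (0 : ℝ) ≤ |x| ^ j := by positivity
  have hm : 1 + |x| ≤ 2 * max 1 |x| := by
    linarith [le_max_left 1 |x|, le_max_right 1 |x|]
  calc (1 + |x|) ^ j ≤ (2 * max 1 |x|) ^ j := by gcongr
    _ = 2 ^ j * max 1 |x| ^ j := mul_pow _ _ _
    _ ≤ 2 ^ j * (1 + |x| ^ j) := by
        gcongr
        rcases max_choice 1 |x| with h | h <;> rw [h]
        · rw [one_pow]; linarith
        · linarith
    _ ≤ _ := mul_le_mul_of_nonneg_left (by linarith) (by positivity)

section

variable {Ω : Type} [MeasurableSpace Ω] [Finite Ω] [DiscreteMeasurableSpace Ω] {P : Measure Ω}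
  [IsProbabilityMeasure P]

lemma IndepFun.integral_mul_comp_of_finite {Ω : Type} [MeasurableSpace Ω]
    [DiscreteMeasurableSpace Ω] {P : Measure Ω} {U V : Ω → ℝ} (h : IndepFun U V P) (f : ℝ → ℝ)
    (hf : Measurable f) :
    ∫ ω, U ω * f (V ω) ∂P = (∫ ω, U ω ∂P) * ∫ ω, f (V ω) ∂P :=
  (h.comp measurable_id hf).integral_fun_mul_eq_mul_integral
    Measurable.of_discrete.aestronglyMeasurable Measurable.of_discrete.aestronglyMeasurable

lemma abs_integral_le_of_abs_le {f g : Ω → ℝ} {c : ℝ} (h : ∀ ω, |f ω| ≤ c * g ω) :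
    |∫ ω, f ω ∂P| ≤ c * ∫ ω, g ω ∂P := by
  rw [← integral_const_mul]
  exact (norm_integral_le_integral_norm f).trans
    (integral_mono (f := fun ω => ‖f ω‖) Integrable.of_finite Integrable.of_finite fun ω => h ω)

/-- The contribution of one summand `U` to Stein's identity for the moments of `W`, where `A` and
`B` are the parts of `W` in a first and a second neighbourhood of `U`. -/
lemma abs_stein_summand_le {U A B W : Ω → ℝ} {ε D : ℝ} (hε : 0 ≤ ε) (hD : 0 ≤ D)
    (hDε : D * ε ≤ 1) (hU : ∀ ω, |U ω| ≤ ε) (hA : ∀ ω, |A ω| ≤ D * ε) (hB : ∀ ω, |B ω| ≤ D * ε)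
    (h0 : ∫ ω, U ω ∂P = 0) (h1 : IndepFun U (fun ω => W ω - A ω) P)
    (h2 : IndepFun (fun ω => U ω * A ω) (fun ω => W ω - B ω) P) (j : ℕ) :
    |∫ ω, U ω * W ω ^ (j + 1) ∂P - (j + 1) * (∫ ω, U ω * A ω ∂P) * ∫ ω, W ω ^ j ∂P| ≤
      ε ^ 3 * D ^ 2 * (j ^ 2 + 3 * ((j + 1) * (j * 2 ^ j))) * ∫ ω, (1 + |W ω|) ^ j ∂P := by
  set δ := D * ε with hδ
  have hδ0 : 0 ≤ δ := by positivity
  set E := ∫ ω, (1 + |W ω|) ^ j ∂P with hE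
  have hE0 : 0 ≤ E := integral_nonneg fun ω => by positivity
  have hpow : ∀ {x a : ℝ}, |a| ≤ δ → |(x - a) ^ j - x ^ j| ≤ δ * (j * 2 ^ j) * (1 + |x|) ^ j := by
    intro x a ha
    refine (abs_pow_sub_pow_le_of_abs_sub_le (M := 1 + |x|) hδ0 hDε (by positivity) (by simp) ?_
      j).trans_eq (by ring)
    rw [sub_sub_cancel_left, abs_neg]
    nlinarith [abs_nonneg x]
  have hUA : ∀ ω, |U ω * A ω| ≤ ε * δ := fun ω => by
    rw [abs_mul]
    exact mul_le_mul (hU ω) (hA ω) (abs_nonneg _) hε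
  -- As U is centered and independent of W - A, the term E[U (W - A)^{j+1}] vanishes.
  have e1 := IndepFun.integral_mul_comp_of_finite h1 (fun x => x ^ (j + 1)) (by fun_prop)
  rw [h0, zero_mul] at e1
  have e2 := IndepFun.integral_mul_comp_of_finite h2 (fun x => x ^ j) (by fun_prop)
  have hT1 : |∫ ω, U ω * (W ω ^ (j + 1) - (W ω - A ω) ^ (j + 1) -
      (j + 1) * A ω * (W ω - A ω) ^ j) ∂P| ≤ ε * (δ ^ 2 * j ^ 2) * E := by
    refine abs_integral_le_of_abs_le fun ω => ?_
    rw [abs_mul, mul_assoc ε]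
    refine mul_le_mul (hU ω) ?_ (abs_nonneg _) hε
    exact (abs_pow_succ_sub_taylor_le (hA ω) hDε j).trans_eq (by ring)
  have hT2 : |∫ ω, U ω * A ω * ((W ω - A ω) ^ j - (W ω - B ω) ^ j) ∂P| ≤
      ε * δ * (2 * (δ * (j * 2 ^ j))) * E := by
    refine abs_integral_le_of_abs_le fun ω => ?_
    rw [abs_mul, mul_assoc (ε * δ)]
    refine mul_le_mul (hUA ω) ?_ (abs_nonneg _) (by positivity)
    have h3 := hpow (x := W ω) (hA ω)
    have h4 := hpow (x := W ω) (hB ω)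
    have h5 := abs_sub ((W ω - A ω) ^ j - W ω ^ j) ((W ω - B ω) ^ j - W ω ^ j)
    rw [sub_sub_sub_cancel_right] at h5
    linarith
  have hT3 : |∫ ω, ((W ω - B ω) ^ j - W ω ^ j) ∂P| ≤ δ * (j * 2 ^ j) * E :=
    abs_integral_le_of_abs_le fun ω => hpow (hB ω)
  have hUA' : |∫ ω, U ω * A ω ∂P| ≤ ε * δ := by
    have := abs_integral_le_of_abs_le (P := P) (f := fun ω => U ω * A ω) (g := fun _ => 1)
      (c := ε * δ) (by simpa using hUA)
    simpa using this
  -- Three errors, each of order ε³D²: the second-order Taylor remainder at W - A; replacing (W -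
  -- A)^j by (W - B)^j, which is independent of UA; and, after factoring, replacing (W - B)^j by
  -- W^j.
  have hsplit : ∫ ω, U ω * W ω ^ (j + 1) ∂P - (j + 1) * (∫ ω, U ω * A ω ∂P) * ∫ ω, W ω ^ j ∂P =
      (∫ ω, U ω * (W ω ^ (j + 1) - (W ω - A ω) ^ (j + 1) -
        (j + 1) * A ω * (W ω - A ω) ^ j) ∂P) +
      (j + 1) * (∫ ω, U ω * A ω * ((W ω - A ω) ^ j - (W ω - B ω) ^ j) ∂P) +
      (j + 1) * ((∫ ω, U ω * A ω ∂P) * ∫ ω, ((W ω - B ω) ^ j - W ω ^ j) ∂P) := by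
    rw [integral_sub (f := fun ω => (W ω - B ω) ^ j) Integrable.of_finite Integrable.of_finite,
      mul_sub, ← e2]
    have e3 : ∫ ω, U ω * (W ω ^ (j + 1) - (W ω - A ω) ^ (j + 1) -
        (j + 1) * A ω * (W ω - A ω) ^ j) ∂P = ∫ ω, U ω * W ω ^ (j + 1) ∂P -
        ∫ ω, U ω * (W ω - A ω) ^ (j + 1) ∂P - (j + 1) * ∫ ω, U ω * A ω * (W ω - A ω) ^ j ∂P := by
      rw [← integral_const_mul, ← integral_sub Integrable.of_finite Integrable.of_finite,
        ← integral_sub Integrable.of_finite Integrable.of_finite]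
      exact integral_congr_ae (ae_of_all _ fun ω => by ring)
    have e4 : ∫ ω, U ω * A ω * ((W ω - A ω) ^ j - (W ω - B ω) ^ j) ∂P =
        ∫ ω, U ω * A ω * (W ω - A ω) ^ j ∂P - ∫ ω, U ω * A ω * (W ω - B ω) ^ j ∂P := by
      rw [← integral_sub Integrable.of_finite Integrable.of_finite]
      exact integral_congr_ae (ae_of_all _ fun ω => by ring)
    rw [e3, e4, e1]
    ring
  rw [hsplit]
  calc _ ≤ ε * (δ ^ 2 * j ^ 2) * E + (j + 1) * (ε * δ * (2 * (δ * (j * 2 ^ j))) * E) +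
        (j + 1) * (ε * δ * (δ * (j * 2 ^ j) * E)) := by
        refine (abs_add_three _ _ _).trans ?_
        rw [abs_mul (j + 1 : ℝ), abs_mul (j + 1 : ℝ), abs_of_nonneg (a := (j + 1 : ℝ))
          (by positivity), abs_mul (∫ ω, U ω * A ω ∂P)]
        gcongr
    _ = _ := by rw [hδ]; ring

lemma abs_stein_moment_le {ι : Type} [Fintype ι] {ξ : ι → Ω → ℝ} {N₁ N₂ : ι → Finset ι}
    {ε : ℝ} {D : ℕ} (hε : 0 ≤ ε) (hDε : D * ε ≤ 1) (hξ : ∀ i ω, |ξ i ω| ≤ ε)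
    (hN₁ : ∀ i, (N₁ i).card ≤ D) (hN₂ : ∀ i, (N₂ i).card ≤ D) (h0 : ∀ i, ∫ ω, ξ i ω ∂P = 0)
    (h1 : ∀ i, IndepFun (ξ i) (fun ω => ∑ k, ξ k ω - ∑ k ∈ N₁ i, ξ k ω) P)
    (h2 : ∀ i, IndepFun (fun ω => ξ i ω * ∑ k ∈ N₁ i, ξ k ω)
      (fun ω => ∑ k, ξ k ω - ∑ k ∈ N₂ i, ξ k ω) P) (j : ℕ) :
    |∫ ω, (∑ k, ξ k ω) ^ (j + 2) ∂P -
        (j + 1) * (∫ ω, (∑ k, ξ k ω) ^ 2 ∂P) * ∫ ω, (∑ k, ξ k ω) ^ j ∂P| ≤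
      Fintype.card ι * (ε ^ 3 * (D : ℝ) ^ 2 * (j ^ 2 + 3 * ((j + 1) * (j * 2 ^ j))) *
        ∫ ω, (1 + |∑ k, ξ k ω|) ^ j ∂P) := by
  have hsum : ∀ (s : Finset ι) ω, s.card ≤ D → |∑ k ∈ s, ξ k ω| ≤ D * ε := by
    intro s ω hs
    calc |∑ k ∈ s, ξ k ω| ≤ ∑ k ∈ s, |ξ k ω| := Finset.abs_sum_le_sum_abs _ _
      _ ≤ ∑ _k ∈ s, ε := Finset.sum_le_sum fun k _ => hξ k ω
      _ = s.card * ε := by rw [Finset.sum_const, nsmul_eq_mul]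
      _ ≤ D * ε := by gcongr
  have hexp : ∀ m : ℕ, ∫ ω, (∑ k, ξ k ω) ^ (m + 1) ∂P =
      ∑ i, ∫ ω, ξ i ω * (∑ k, ξ k ω) ^ m ∂P := by
    intro m
    rw [← integral_finsetSum _ fun _ _ => Integrable.of_finite]
    refine integral_congr_ae (ae_of_all _ fun ω => ?_)
    simp only
    rw [← Finset.sum_mul, pow_succ']
  -- Summands outside `N₁ i` do not contribute, so the factors E[U A] add up to the full variance.
  have hvar : ∫ ω, (∑ k, ξ k ω) ^ 2 ∂P = ∑ i, ∫ ω, ξ i ω * ∑ k ∈ N₁ i, ξ k ω ∂P := by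
    rw [hexp 1]
    refine Finset.sum_congr rfl fun i _ => ?_
    have e1 := IndepFun.integral_mul_comp_of_finite (h1 i) (fun x => x) measurable_id
    rw [h0, zero_mul] at e1
    rw [← sub_eq_zero, ← e1, ← integral_sub Integrable.of_finite Integrable.of_finite]
    exact integral_congr_ae (ae_of_all _ fun ω => by ring)
  rw [hexp (j + 1), hvar, Finset.mul_sum, Finset.sum_mul, ← Finset.sum_sub_distrib]
  refine (Finset.abs_sum_le_sum_abs _ _).trans ((Finset.sum_le_sum fun i _ =>
    abs_stein_summand_le hε (Nat.cast_nonneg D) hDε (hξ i) (fun ω => hsum _ ω (hN₁ i))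
      (fun ω => hsum _ ω (hN₂ i)) (h0 i) (h1 i) (h2 i) j).trans_eq ?_)
  rw [Finset.sum_const, nsmul_eq_mul, Finset.card_univ]

end

/-- Convergence of moments to the Gaussian ones for sums of bounded, locally dependent random
variables. -/
theorem tendsto_moments_of_local_dependence {Ω : ℕ → Type} [∀ n, MeasurableSpace (Ω n)]
    [∀ n, Finite (Ω n)] [∀ n, DiscreteMeasurableSpace (Ω n)] {P : ∀ n, Measure (Ω n)}
    [∀ n, IsProbabilityMeasure (P n)] {ι : ℕ → Type} [∀ n, Fintype (ι n)]
    {ξ : ∀ n, ι n → Ω n → ℝ} {N₁ N₂ : ∀ n, ι n → Finset (ι n)} {ε : ℕ → ℝ} {D : ℕ} {v : ℝ}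
    (hε : ∀ n, 0 ≤ ε n) (hε0 : Tendsto ε atTop (𝓝 0))
    (hε3 : Tendsto (fun n => Fintype.card (ι n) * ε n ^ 3) atTop (𝓝 0))
    (hξ : ∀ n i ω, |ξ n i ω| ≤ ε n) (hN₁ : ∀ n i, (N₁ n i).card ≤ D)
    (hN₂ : ∀ n i, (N₂ n i).card ≤ D) (h0 : ∀ n i, ∫ ω, ξ n i ω ∂(P n) = 0)
    (h1 : ∀ n i, IndepFun (ξ n i) (fun ω => ∑ k, ξ n k ω - ∑ k ∈ N₁ n i, ξ n k ω) (P n))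
    (h2 : ∀ n i, IndepFun (fun ω => ξ n i ω * ∑ k ∈ N₁ n i, ξ n k ω)
      (fun ω => ∑ k, ξ n k ω - ∑ k ∈ N₂ n i, ξ n k ω) (P n))
    (hv : Tendsto (fun n => ∫ ω, (∑ k, ξ n k ω) ^ 2 ∂(P n)) atTop (𝓝 v)) (m : ℕ) :
    Tendsto (fun n => ∫ ω, (∑ k, ξ n k ω) ^ m ∂(P n)) atTop
      (𝓝 (v ^ (m / 2) * gaussMoment m)) := by
  induction m using Nat.strong_induction_on with
  | _ m ih =>
    match m with
    | 0 => simp [gaussMoment]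
    | 1 =>
      have : ∀ n, ∫ ω, (∑ k, ξ n k ω) ^ 1 ∂(P n) = 0 := fun n => by
        simp only [pow_one]
        rw [integral_finsetSum _ fun _ _ => Integrable.of_finite]
        exact Finset.sum_eq_zero fun i _ => h0 n i
      simp_rw [this]
      simp [gaussMoment]
    | j + 2 =>
      -- The Stein recursion has the same form as the recursion that defines `gaussMoment`.
      have hmain : Tendsto (fun n => (j + 1 : ℝ) * (∫ ω, (∑ k, ξ n k ω) ^ 2 ∂(P n)) *
          ∫ ω, (∑ k, ξ n k ω) ^ j ∂(P n)) atTop (𝓝 (v ^ ((j + 2) / 2) * gaussMoment (j + 2))) := by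
        have := (hv.const_mul (j + 1 : ℝ)).mul (ih j (by omega))
        convert this using 2
        rw [gaussMoment, Nat.add_div_right _ two_pos, pow_succ]
        ring
      set K : ℝ := (D : ℝ) ^ 2 * (j ^ 2 + 3 * ((j + 1) * (j * 2 ^ j))) with hK
      have hbd : Tendsto (fun n => Fintype.card (ι n) * ε n ^ 3 * (K * (2 ^ j * (2 +
          ∫ ω, (∑ k, ξ n k ω) ^ (2 * ((j + 1) / 2)) ∂(P n))))) atTop (𝓝 0) := by
        have := hε3.mul ((((ih (2 * ((j + 1) / 2)) (by omega)).const_add 2).const_mul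
          ((2 : ℝ) ^ j)).const_mul K)
        rwa [zero_mul] at this
      have hdiff := squeeze_zero_norm' (f := fun n => ∫ ω, (∑ k, ξ n k ω) ^ (j + 2) ∂(P n) -
        (j + 1 : ℝ) * (∫ ω, (∑ k, ξ n k ω) ^ 2 ∂(P n)) * ∫ ω, (∑ k, ξ n k ω) ^ j ∂(P n)) ?_ hbd
      · simpa using hdiff.add hmain
      · have hDε : Tendsto (fun n => D * ε n) atTop (𝓝 0) := by simpa using hε0.const_mul (D : ℝ)
        filter_upwards [hDε.eventually (ge_mem_nhds zero_lt_one)] with n hn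
        refine (abs_stein_moment_le (hε n) hn (hξ n) (hN₁ n) (hN₂ n) (h0 n) (h1 n) (h2 n)
          j).trans ?_
        have hE : ∫ ω, (1 + |∑ k, ξ n k ω|) ^ j ∂(P n) ≤
            2 ^ j * (2 + ∫ ω, (∑ k, ξ n k ω) ^ (2 * ((j + 1) / 2)) ∂(P n)) := by
          calc _ ≤ ∫ ω, 2 ^ j * (2 + (∑ k, ξ n k ω) ^ (2 * ((j + 1) / 2))) ∂(P n) :=
                integral_mono Integrable.of_finite Integrable.of_finite
                  fun ω => one_add_abs_pow_le _ j
            _ = _ := by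
                rw [integral_const_mul, integral_add Integrable.of_finite Integrable.of_finite]
                simp
        have := hε n
        calc _ = Fintype.card (ι n) * ε n ^ 3 * (K * ∫ ω, (1 + |∑ k, ξ n k ω|) ^ j ∂(P n)) := by
              rw [hK]; ring
          _ ≤ _ := by gcongr

/-! ### Independent uniform digits -/

/-- Sequences `d₀, …, d_{n-1}` of digits with `d_k ≤ k`. -/
abbrev LehmerCode (n : ℕ) : Type := (k : Fin n) → Fin ((k : ℕ) + 1)

instance unifFin_isProbabilityMeasure (k : ℕ) :
    IsProbabilityMeasure (uniformOn (Set.univ : Set (Fin (k + 1)))) :=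
  isProbabilityMeasure_uniformOn Set.finite_univ Set.univ_nonempty

/-- The distribution of a sequence of independent, uniformly distributed digits. -/
def unifCode (n : ℕ) : Measure (LehmerCode n) :=
  Measure.pi fun k : Fin n => uniformOn (Set.univ : Set (Fin ((k : ℕ) + 1)))

instance unifCode_isProbabilityMeasure (n : ℕ) : IsProbabilityMeasure (unifCode n) := by
  unfold unifCode
  infer_instance

namespace LehmerCode

variable {n : ℕ}

/-- The digit with index `k`, which is `0` if there is none. -/
def digit (ω : LehmerCode n) (k : ℕ) : ℕ := if h : k < n then ω ⟨k, h⟩ else 0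

lemma digit_le (ω : LehmerCode n) (k : ℕ) : ω.digit k ≤ k := by
  unfold digit
  split_ifs with h
  · exact Nat.lt_succ_iff.1 (ω ⟨k, h⟩).2
  · exact Nat.zero_le k

lemma digit_congr {ω ω' : LehmerCode n} {S : Set (Fin n)} (h : ∀ j ∈ S, ω j = ω' j) {k : ℕ}
    (hk : ∀ h : k < n, (⟨k, h⟩ : Fin n) ∈ S) : ω.digit k = ω'.digit k := by
  unfold digit
  split_ifs with h1
  · rw [h _ (hk h1)]
  · rfl

lemma indepFun_of_dependsOn {β γ : Type*} [MeasurableSpace β] [MeasurableSpace γ] [Nonempty β]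
    [Nonempty γ] {f : LehmerCode n → β} {g : LehmerCode n → γ} {S T : Set (Fin n)}
    (hf : DependsOn f S) (hg : DependsOn g T) (hST : Disjoint S T) :
    IndepFun f g (unifCode n) := by
  classical
  obtain ⟨f', rfl⟩ := dependsOn_iff_exists_comp.1 hf
  obtain ⟨g', rfl⟩ := dependsOn_iff_exists_comp.1 hg
  have h := (iIndepFun_pi (μ := fun k : Fin n => uniformOn (Set.univ : Set (Fin ((k : ℕ) + 1))))
    (X := fun _ x => x) fun _ => aemeasurable_id).indepFun_finset S.toFinset T.toFinset
    (by simpa using hST) fun i => measurable_pi_apply i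
  have hF : Measurable fun u : (i : S.toFinset) → Fin ((i : Fin n) + 1 : ℕ) =>
      f' fun i => u ⟨i.1, by simp⟩ := Measurable.of_discrete
  have hG : Measurable fun u : (i : T.toFinset) → Fin ((i : Fin n) + 1 : ℕ) =>
      g' fun i => u ⟨i.1, by simp⟩ := Measurable.of_discrete
  exact h.comp hF hG

lemma integral_ite_digit_eq {i : ℕ} (hi : i < n) {a : ℕ} (ha : a < i + 1) :
    ∫ ω : LehmerCode n, (if ω.digit i = a then (1 : ℝ) else 0) ∂(unifCode n) = 1 / (i + 1) := by
  have h := measurePreserving_eval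
    (fun k : Fin n => uniformOn (Set.univ : Set (Fin ((k : ℕ) + 1)))) ⟨i, hi⟩
  have h1 : ∀ ω : LehmerCode n, (if ω.digit i = a then (1 : ℝ) else 0) =
      (fun b : Fin (i + 1) => if (b : ℕ) = a then (1 : ℝ) else 0)
        (Function.eval (⟨i, hi⟩ : Fin n) ω) := fun ω => by
    simp [digit, hi]
  have h2 := integral_map (μ := unifCode n) h.measurable.aemeasurable
    (f := fun b : Fin (i + 1) => if (b : ℕ) = a then (1 : ℝ) else 0)
    Measurable.of_discrete.aestronglyMeasurable
  rw [integral_congr_ae (ae_of_all _ h1), ← h2, unifCode,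
    h.map_eq, integral_fintype Integrable.of_finite, Finset.sum_eq_single (⟨a, ha⟩ : Fin (i + 1))]
  · simp [measureReal_def, uniformOn_univ, ENNReal.toReal_add]
  · intro b _ hb
    have : (b : ℕ) ≠ a := fun h => hb (Fin.ext h)
    simp [this]
  · simp

/-- Averaging over one digit. -/
lemma integral_digit_average {i : ℕ} (hi : i < n) (F : ℕ → LehmerCode n → ℝ)
    (hF : ∀ a, DependsOn (F a) {j : Fin n | (j : ℕ) ≠ i}) :
    ∫ ω, F (ω.digit i) ω ∂(unifCode n) =
      ∫ ω, 1 / ((i : ℝ) + 1) * ∑ a ∈ Finset.range (i + 1), F a ω ∂(unifCode n) := by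
  have h1 : ∀ ω : LehmerCode n, F (ω.digit i) ω =
      ∑ a ∈ Finset.range (i + 1), (if ω.digit i = a then 1 else 0) * F a ω := fun ω => by
    have := ω.digit_le i
    simp [Finset.sum_ite_eq, this]
  simp_rw [h1]
  rw [integral_const_mul, integral_finsetSum _ fun _ _ => Integrable.of_finite,
    integral_finsetSum _ fun _ _ => Integrable.of_finite, Finset.mul_sum]
  refine Finset.sum_congr rfl fun a ha => ?_
  have hd : DependsOn (fun ω : LehmerCode n => if ω.digit i = a then (1 : ℝ) else 0)
      {j : Fin n | (j : ℕ) = i} := fun ω ω' h => by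
    simp only
    rw [digit_congr h (k := i) fun _ => rfl]
  have hind := indepFun_of_dependsOn hd (hF a)
    (Set.disjoint_left.2 fun j (h1 : (j : ℕ) = i) h2 => h2 h1)
  rw [hind.integral_fun_mul_eq_mul_integral Measurable.of_discrete.aestronglyMeasurable
    Measurable.of_discrete.aestronglyMeasurable, integral_ite_digit_eq hi (Finset.mem_range.1 ha)]

/-! ### Means and covariances of digits and ascents -/

/-- The centered digit. -/
def centeredDigit (ω : LehmerCode n) (k : ℕ) : ℝ := (ω.digit k : ℝ) - k / 2

/-- The centered contribution of an ascent of the digits at `k`. -/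
def centeredAscent (ω : LehmerCode n) (k : ℕ) : ℝ :=
  k * ((if ω.digit (k - 1) < ω.digit k then 1 else 0) - 1 / 2)

lemma sum_range_ite_lt {b m : ℕ} (h : b ≤ m) :
    ∑ a ∈ Finset.range m, (if a < b then (1 : ℝ) else 0) = b := by
  rw [Finset.sum_boole]
  congr 1
  have : Finset.filter (fun a => a < b) (Finset.range m) = Finset.range b := by
    ext a
    simp only [Finset.mem_filter, Finset.mem_range]
    omega
  rw [this, Finset.card_range]

lemma sum_range_ite_gt {b m : ℕ} (h : b < m) :
    ∑ a ∈ Finset.range m, (if b < a then (1 : ℝ) else 0) = m - 1 - b := by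
  have h1 : ∀ a : ℕ, (if b < a then (1 : ℝ) else 0) = 1 - if a < b + 1 then 1 else 0 := by
    intro a
    by_cases hab : b < a
    · simp [hab, show ¬ a < b + 1 by omega]
    · simp [hab, show a < b + 1 by omega]
  simp_rw [h1]
  rw [Finset.sum_sub_distrib, sum_range_ite_lt (by omega)]
  simp
  ring

/-- For i > 0, average over digit i - 1, uniform on i values: given d_i = b the ascent has
probability b/i, and i(b/i - 1/2) = b - i/2. For i = 0 both sides vanish. -/
lemma integral_mul_centeredAscent_left {i : ℕ} (hi : i < n) {G : LehmerCode n → ℝ}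
    (hG : DependsOn G {j : Fin n | (j : ℕ) + 1 ≠ i}) :
    ∫ ω, G ω * ω.centeredAscent i ∂(unifCode n) =
      ∫ ω, G ω * ω.centeredDigit i ∂(unifCode n) := by
  rcases i with _ | k
  · refine integral_congr_ae (ae_of_all _ fun ω => ?_)
    have := ω.digit_le 0
    simp [centeredAscent, centeredDigit, Nat.le_zero.1 this]
  · have h := integral_digit_average (i := k) (by omega)
      (fun a ω => G ω * (((k + 1 : ℕ) : ℝ) * ((if a < ω.digit (k + 1) then 1 else 0) - 1 / 2)))
      (fun a ω ω' h => by
        simp only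
        rw [hG fun j hj => h j (by simpa using hj), digit_congr h (k := k + 1) (by simp)])
    unfold centeredAscent
    rw [Nat.add_sub_cancel, h]
    refine integral_congr_ae (ae_of_all _ fun ω => ?_)
    simp only
    rw [← Finset.mul_sum, ← Finset.mul_sum, Finset.sum_sub_distrib,
      sum_range_ite_lt (ω.digit_le (k + 1)), centeredDigit]
    simp
    field_simp

/-- Average over digit i + 1, uniform on i + 2 values: given d_i = b the ascent has probability
(i+1-b)/(i+2), which after centering is a negative multiple of b - i/2. -/
lemma integral_mul_centeredAscent_right {i : ℕ} (hi : i + 1 < n) {G : LehmerCode n → ℝ}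
    (hG : DependsOn G {j : Fin n | (j : ℕ) ≠ i + 1}) :
    ∫ ω, G ω * ω.centeredAscent (i + 1) ∂(unifCode n) =
      -((i + 1) / (i + 2)) * ∫ ω, G ω * ω.centeredDigit i ∂(unifCode n) := by
  have h := integral_digit_average (i := i + 1) hi
    (fun a ω => G ω * (((i + 1 : ℕ) : ℝ) * ((if ω.digit i < a then 1 else 0) - 1 / 2)))
    (fun a ω ω' h => by
      simp only
      rw [hG fun j hj => h j (by simpa using hj), digit_congr h (k := i) (by simp)])
  unfold centeredAscent
  rw [Nat.add_sub_cancel, h, ← integral_const_mul]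
  refine integral_congr_ae (ae_of_all _ fun ω => ?_)
  simp only
  rw [← Finset.mul_sum, ← Finset.mul_sum, Finset.sum_sub_distrib,
    sum_range_ite_gt (by have := ω.digit_le i; omega), centeredDigit]
  have : (i : ℝ) + 2 ≠ 0 := by positivity
  simp
  field_simp
  ring

lemma integral_centeredDigit {i : ℕ} (hi : i < n) :
    ∫ ω : LehmerCode n, ω.centeredDigit i ∂(unifCode n) = 0 := by
  have h := integral_digit_average hi (fun a _ => (a : ℝ) - i / 2) (fun a ω ω' _ => rfl)
  unfold centeredDigit
  rw [h]
  have h2 : ∀ m : ℕ, ∑ a ∈ Finset.range (m + 1), ((a : ℝ) - i / 2) = (m + 1) * (m - i) / 2 := by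
    intro m
    induction m with
    | zero => simp; ring
    | succ m ih => rw [Finset.sum_range_succ, ih]; push_cast; ring
  simp [h2]

lemma integral_centeredDigit_sq {i : ℕ} (hi : i < n) :
    ∫ ω : LehmerCode n, ω.centeredDigit i ^ 2 ∂(unifCode n) = i * (i + 2) / 12 := by
  have h := integral_digit_average hi (fun a _ => ((a : ℝ) - i / 2) ^ 2) (fun a ω ω' _ => rfl)
  unfold centeredDigit
  rw [h]
  have h2 : ∀ m : ℕ, ∑ a ∈ Finset.range (m + 1), ((a : ℝ) - i / 2) ^ 2 =
      ((m : ℝ) + 1) * (m * (2 * m + 1) / 6 - i * m / 2 + (i : ℝ) ^ 2 / 4) := by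
    intro m
    induction m with
    | zero => simp; ring
    | succ m ih => rw [Finset.sum_range_succ, ih]; push_cast; ring
  rw [h2]
  simp
  field_simp
  ring

lemma integral_centeredAscent {i : ℕ} (hi : i < n) :
    ∫ ω : LehmerCode n, ω.centeredAscent i ∂(unifCode n) = 0 := by
  have h := integral_mul_centeredAscent_left hi (G := fun _ => 1) fun _ _ _ => rfl
  simpa [integral_centeredDigit hi] using h

lemma centeredAscent_sq (ω : LehmerCode n) (i : ℕ) : ω.centeredAscent i ^ 2 = i ^ 2 / 4 := by
  unfold centeredAscent
  split_ifs <;> ring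

lemma abs_centeredDigit_le (ω : LehmerCode n) (i : ℕ) : |ω.centeredDigit i| ≤ i := by
  have h : (ω.digit i : ℝ) ≤ i := by exact_mod_cast ω.digit_le i
  have h0 : (0 : ℝ) ≤ ω.digit i := by positivity
  rw [centeredDigit, abs_le]
  constructor <;> linarith

lemma abs_centeredAscent_le (ω : LehmerCode n) (i : ℕ) : |ω.centeredAscent i| ≤ i := by
  have h : (0 : ℝ) ≤ i := by positivity
  unfold centeredAscent
  split_ifs <;> rw [abs_le] <;> constructor <;> linarith

lemma dependsOn_centeredDigit (i : ℕ) :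
    DependsOn (fun ω : LehmerCode n => ω.centeredDigit i) {j : Fin n | (j : ℕ) = i} :=
  fun ω ω' h => by
    simp only [centeredDigit]
    rw [digit_congr h (k := i) (by simp)]

lemma dependsOn_centeredAscent (i : ℕ) :
    DependsOn (fun ω : LehmerCode n => ω.centeredAscent i)
      {j : Fin n | (j : ℕ) ≤ i ∧ i ≤ (j : ℕ) + 1} :=
  fun ω ω' h => by
    simp only [centeredAscent]
    rw [digit_congr h (k := i) (by simp), digit_congr h (k := i - 1) fun h => by
      simp only [Set.mem_ofPred_eq]; omega]

/-- The summands of a linear combination of the centered statistics. -/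
def summand (s t : ℝ) (ω : LehmerCode n) (k : ℕ) : ℝ :=
  s * ω.centeredDigit k + t * ω.centeredAscent k

lemma dependsOn_summand (s t : ℝ) (i : ℕ) :
    DependsOn (fun ω : LehmerCode n => ω.summand s t i)
      {j : Fin n | (j : ℕ) ≤ i ∧ i ≤ (j : ℕ) + 1} :=
  fun ω ω' h => by
    have h1 : centeredDigit ω i = centeredDigit ω' i :=
      (dependsOn_centeredDigit i).mono (by rintro j rfl; simp) h
    have h2 : centeredAscent ω i = centeredAscent ω' i := dependsOn_centeredAscent i h
    simp only [summand, h1, h2]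

lemma integral_summand (s t : ℝ) {i : ℕ} (hi : i < n) :
    ∫ ω : LehmerCode n, ω.summand s t i ∂(unifCode n) = 0 := by
  unfold summand
  rw [integral_add Integrable.of_finite Integrable.of_finite, integral_const_mul,
    integral_const_mul, integral_centeredDigit hi, integral_centeredAscent hi]
  simp

lemma abs_summand_le (s t : ℝ) (ω : LehmerCode n) (i : ℕ) :
    |ω.summand s t i| ≤ (|s| + |t|) * i := by
  unfold summand
  calc _ ≤ |s * ω.centeredDigit i| + |t * ω.centeredAscent i| := abs_add_le _ _
    _ = |s| * |ω.centeredDigit i| + |t| * |ω.centeredAscent i| := by rw [abs_mul, abs_mul]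
    _ ≤ |s| * i + |t| * i := by
        gcongr
        · exact ω.abs_centeredDigit_le i
        · exact ω.abs_centeredAscent_le i
    _ = _ := by ring

lemma integral_centeredDigit_mul_centeredAscent {i : ℕ} (hi : i < n) :
    ∫ ω : LehmerCode n, ω.centeredDigit i * ω.centeredAscent i ∂(unifCode n) =
      i * (i + 2) / 12 := by
  rw [integral_mul_centeredAscent_left hi, ← integral_centeredDigit_sq hi]
  · simp_rw [sq]
  · exact (dependsOn_centeredDigit i).mono (by rintro j rfl; simp)

lemma integral_summand_sq (s t : ℝ) {i : ℕ} (hi : i < n) :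
    ∫ ω : LehmerCode n, ω.summand s t i ^ 2 ∂(unifCode n) =
      (s ^ 2 + 2 * s * t) * (i * (i + 2) / 12) + t ^ 2 * (i ^ 2 / 4) := by
  have h : ∀ ω : LehmerCode n, ω.summand s t i ^ 2 = s ^ 2 * ω.centeredDigit i ^ 2 +
      2 * s * t * (ω.centeredDigit i * ω.centeredAscent i) + t ^ 2 * (i ^ 2 / 4) := fun ω => by
    rw [← ω.centeredAscent_sq i, summand]
    ring
  simp_rw [h]
  rw [integral_add Integrable.of_finite Integrable.of_finite,
    integral_add Integrable.of_finite Integrable.of_finite, integral_const_mul,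
    integral_const_mul, integral_centeredDigit_sq hi, integral_centeredDigit_mul_centeredAscent hi]
  simp
  ring

lemma integral_summand_mul_succ (s t : ℝ) {i : ℕ} (hi : i + 1 < n) :
    ∫ ω : LehmerCode n, ω.summand s t i * ω.summand s t (i + 1) ∂(unifCode n) =
      -(s * t + t ^ 2) * (i * (i + 1) / 12) := by
  have hdep : DependsOn (fun ω : LehmerCode n => ω.summand s t i)
      {j : Fin n | (j : ℕ) ≠ i + 1} :=
    (dependsOn_summand s t i).mono fun j hj => by
      simp only [Set.mem_ofPred_eq] at hj ⊢
      omega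
  have h1 : ∫ ω : LehmerCode n, ω.summand s t i * ω.centeredDigit (i + 1) ∂(unifCode n) = 0 := by
    rw [(indepFun_of_dependsOn hdep (dependsOn_centeredDigit (i + 1))
      (Set.disjoint_left.2 fun j h1 h2 => h1 h2)).integral_fun_mul_eq_mul_integral
      Measurable.of_discrete.aestronglyMeasurable Measurable.of_discrete.aestronglyMeasurable,
      integral_centeredDigit hi, mul_zero]
  have h2 : ∫ ω : LehmerCode n, ω.summand s t i * ω.centeredDigit i ∂(unifCode n) =
      (s + t) * (i * (i + 2) / 12) := by
    have h : ∀ ω : LehmerCode n, ω.summand s t i * ω.centeredDigit i =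
        s * ω.centeredDigit i ^ 2 + t * (ω.centeredDigit i * ω.centeredAscent i) := fun ω => by
      rw [summand]
      ring
    simp_rw [h]
    rw [integral_add Integrable.of_finite Integrable.of_finite, integral_const_mul,
      integral_const_mul, integral_centeredDigit_sq (by omega),
      integral_centeredDigit_mul_centeredAscent (by omega)]
    ring
  have h : ∀ ω : LehmerCode n, ω.summand s t i * ω.summand s t (i + 1) =
      s * (ω.summand s t i * ω.centeredDigit (i + 1)) +
        t * (ω.summand s t i * ω.centeredAscent (i + 1)) := fun ω => by
    rw [summand, summand]
    ring
  simp_rw [h]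
  rw [integral_add Integrable.of_finite Integrable.of_finite, integral_const_mul,
    integral_const_mul, h1, integral_mul_centeredAscent_right hi hdep, h2]
  have : (i : ℝ) + 2 ≠ 0 := by positivity
  field_simp
  ring

lemma dependsOn_sum_summand (s t : ℝ) (A : Finset ℕ) {T : Set (Fin n)}
    (h : ∀ k ∈ A, ∀ j : Fin n, (j : ℕ) ≤ k ∧ k ≤ (j : ℕ) + 1 → j ∈ T) :
    DependsOn (fun ω : LehmerCode n => ∑ k ∈ A, ω.summand s t k) T :=
  fun _ _ hω => Finset.sum_congr rfl fun k hk =>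
    (dependsOn_summand s t k).mono (h k hk) hω

/-- The coefficient of st is twice the covariance of the two statistics. It has degree 2 in m while
the variances have degree 3. -/
lemma integral_sum_summand_sq (s t : ℝ) {m : ℕ} (hm : m ≤ n) :
    ∫ ω : LehmerCode n, (∑ k ∈ Finset.range m, ω.summand s t k) ^ 2 ∂(unifCode n) =
      (s ^ 2 + t ^ 2) * ((2 * (m : ℝ) ^ 3 + 3 * (m : ℝ) ^ 2 - 5 * m) / 72) +
        s * t * (m * (m - 1) / 4) := by
  induction m with
  | zero => simp
  | succ m ih =>
    -- Only the immediate predecessor shares a digit with summand m; the earlier ones are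
    -- independent of it.
    have hcross : ∫ ω : LehmerCode n,
        (∑ k ∈ Finset.range m, ω.summand s t k) * ω.summand s t m ∂(unifCode n) =
        -(s * t + t ^ 2) * (m * (m - 1) / 12) := by
      rcases m with _ | l
      · simp
      · have hind := indepFun_of_dependsOn
          (dependsOn_sum_summand (n := n) s t (Finset.range l) (T := {j : Fin n | (j : ℕ) < l})
            fun k hk j hj => by
              simp only [Finset.mem_range] at hk
              simp only [Set.mem_ofPred_eq]
              omega)
          (dependsOn_summand s t (l + 1))
          (Set.disjoint_left.2 fun j h1 h2 => by
            simp only [Set.mem_ofPred_eq] at h1 h2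
            omega)
        simp_rw [Finset.sum_range_succ, add_mul]
        rw [integral_add Integrable.of_finite Integrable.of_finite,
          hind.integral_fun_mul_eq_mul_integral Measurable.of_discrete.aestronglyMeasurable
            Measurable.of_discrete.aestronglyMeasurable, integral_summand s t (i := l + 1) (by omega),
          integral_summand_mul_succ s t (by omega)]
        push_cast
        ring
    have h : ∀ ω : LehmerCode n, (∑ k ∈ Finset.range (m + 1), ω.summand s t k) ^ 2 =
        (∑ k ∈ Finset.range m, ω.summand s t k) ^ 2 +
        2 * ((∑ k ∈ Finset.range m, ω.summand s t k) * ω.summand s t m) +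
        ω.summand s t m ^ 2 := fun ω => by
      rw [Finset.sum_range_succ]
      ring
    simp_rw [h]
    rw [integral_add Integrable.of_finite Integrable.of_finite,
      integral_add Integrable.of_finite Integrable.of_finite, integral_const_mul, hcross,
      ih (by omega), integral_summand_sq s t (by omega)]
    push_cast
    ring

end LehmerCode

/-! ### The size of σ_n -/

lemma sigmaInv_sq {n : ℕ} (hn : 2 ≤ n) :
    sigmaInv n ^ 2 = (2 * (n : ℝ) ^ 3 + 3 * (n : ℝ) ^ 2 - 5 * (n : ℝ)) / 72 := by
  have h : (2 : ℝ) ≤ n := by exact_mod_cast hn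
  exact Real.sq_sqrt (by nlinarith [pow_pos (by linarith : (0 : ℝ) < n) 3])

lemma pow_three_le_sigmaInv_sq {n : ℕ} (hn : 2 ≤ n) : (n : ℝ) ^ 3 / 36 ≤ sigmaInv n ^ 2 := by
  have h : (2 : ℝ) ≤ n := by exact_mod_cast hn
  rw [sigmaInv_sq hn]
  nlinarith

lemma sigmaInv_pos {n : ℕ} (hn : 2 ≤ n) : 0 < sigmaInv n := by
  have h := pow_three_le_sigmaInv_sq hn
  have h0 : (0 : ℝ) < n := by exact_mod_cast (by omega : 0 < n)
  have h1 : 0 ≤ sigmaInv n := Real.sqrt_nonneg _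
  have h2 : 0 < sigmaInv n ^ 2 := lt_of_lt_of_le (by positivity) h
  exact lt_of_le_of_ne h1 fun h => by simp [← h] at h2

lemma sigmaInv_eq_zero {n : ℕ} (hn : n < 2) : sigmaInv n = 0 := by
  interval_cases n <;> norm_num [sigmaInv]

/-- This follows from σ_n² ≥ n³/36. For n < 2 division by σ_n = 0 gives 0, so the bound holds
without restriction. -/
lemma div_sigmaInv_le (n : ℕ) : (n : ℝ) / sigmaInv n ≤ 6 / Real.sqrt n := by
  rcases lt_or_ge n 2 with hn | hn
  · rw [sigmaInv_eq_zero hn, div_zero]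
    positivity
  · have h0 : (0 : ℝ) < n := by exact_mod_cast (by omega : 0 < n)
    rw [div_le_div_iff₀ (sigmaInv_pos hn) (Real.sqrt_pos.2 h0)]
    refine (sq_le_sq₀ (by positivity) (by have := sigmaInv_pos hn; positivity)).1 ?_
    rw [mul_pow, Real.sq_sqrt h0.le, mul_pow]
    linarith [pow_three_le_sigmaInv_sq hn]

lemma tendsto_const_div_sqrt (K : ℝ) :
    Tendsto (fun n : ℕ => K / Real.sqrt n) atTop (𝓝 0) :=
  (Real.tendsto_sqrt_atTop.comp tendsto_natCast_atTop_atTop).const_div_atTop K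

/-! ### Mixed moments of the digit statistics -/

namespace LehmerCode

variable {n : ℕ}

/-- The number of inversions in terms of the digits. -/
def inv (ω : LehmerCode n) : ℕ := ∑ k ∈ Finset.range n, ω.digit k

/-- The major index in terms of the digits. -/
def maj (ω : LehmerCode n) : ℕ :=
  ∑ k ∈ Finset.range n, k * if ω.digit (k - 1) < ω.digit k then 1 else 0

/-- The normalized number of inversions. -/
def normInv (ω : LehmerCode n) : ℝ := ((ω.inv : ℝ) - meanInv n) / sigmaInv n

/-- The normalized major index. -/
def normMaj (ω : LehmerCode n) : ℝ := ((ω.maj : ℝ) - meanInv n) / sigmaInv n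

lemma meanInv_eq_sum (n : ℕ) : meanInv n = ∑ k ∈ Finset.range n, (k : ℝ) / 2 := by
  induction n with
  | zero => simp [meanInv]
  | succ n ih =>
    rw [Finset.sum_range_succ, ← ih, meanInv, meanInv]
    push_cast
    ring

lemma linear_combination_eq_sum (s t : ℝ) (ω : LehmerCode n) :
    s * ω.normInv + t * ω.normMaj = ∑ k : Fin n, ω.summand s t k / sigmaInv n := by
  rw [Fin.sum_univ_eq_sum_range fun k => ω.summand s t k / sigmaInv n, ← Finset.sum_div]
  have h1 : (ω.inv : ℝ) - meanInv n = ∑ k ∈ Finset.range n, ω.centeredDigit k := by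
    rw [meanInv_eq_sum, inv, Nat.cast_sum, ← Finset.sum_sub_distrib]
    rfl
  have h2 : (ω.maj : ℝ) - meanInv n = ∑ k ∈ Finset.range n, ω.centeredAscent k := by
    rw [meanInv_eq_sum, maj, Nat.cast_sum, ← Finset.sum_sub_distrib]
    refine Finset.sum_congr rfl fun k _ => ?_
    rw [centeredAscent]
    push_cast
    ring
  simp only [summand]
  rw [normInv, normMaj, h1, h2, Finset.sum_add_distrib, ← Finset.mul_sum, ← Finset.mul_sum]
  ring

/-- The indices at distance at most `r` from `i`. -/
def nbhd (n r : ℕ) (i : Fin n) : Finset (Fin n) :=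
  Finset.univ.filter fun j => (j : ℕ) ≤ i + r ∧ (i : ℕ) ≤ j + r

lemma card_nbhd_le (r : ℕ) (i : Fin n) : (nbhd n r i).card ≤ 2 * r + 1 := by
  have h := Finset.card_le_card_of_injOn (s := nbhd n r i)
    (t := Finset.Icc ((i : ℕ) - r) (i + r)) (fun j => (j : ℕ))
    (fun j hj => by
      simp only [nbhd, Finset.coe_filter, Finset.mem_univ, true_and, Set.mem_ofPred_eq] at hj
      simp only [Finset.coe_Icc, Set.mem_Icc]
      omega)
    (Fin.val_injective.injOn)
  rw [Nat.card_Icc] at h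
  omega

lemma dependsOn_sum_summand_div (s t c : ℝ) (A : Finset (Fin n)) {T : Set (Fin n)}
    (h : ∀ k ∈ A, ∀ j : Fin n, (j : ℕ) ≤ k ∧ (k : ℕ) ≤ (j : ℕ) + 1 → j ∈ T) :
    DependsOn (fun ω : LehmerCode n => ∑ k ∈ A, ω.summand s t k / c) T :=
  fun _ _ hω => Finset.sum_congr rfl fun k hk =>
    congrArg (· / c) ((dependsOn_summand s t k).mono (h k hk) hω)

lemma sum_sub_sum_eq_sum_compl {M : Type*} [AddCommGroup M] (A : Finset (Fin n))
    (f : Fin n → M) : ∑ k, f k - ∑ k ∈ A, f k = ∑ k ∈ Aᶜ, f k := by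
  rw [← Finset.sum_add_sum_compl A f, add_sub_cancel_left]

lemma indepFun_summand (s t c : ℝ) (i : Fin n) :
    IndepFun (fun ω : LehmerCode n => ω.summand s t i / c)
      (fun ω => ∑ k : Fin n, ω.summand s t k / c - ∑ k ∈ nbhd n 1 i, ω.summand s t k / c)
      (unifCode n) := by
  simp_rw [sum_sub_sum_eq_sum_compl]
  have h1 := dependsOn_sum_summand_div s t c {i}
    (T := {j : Fin n | (j : ℕ) ≤ i ∧ (i : ℕ) ≤ j + 1})
    fun k hk j hj => by rwa [Finset.mem_singleton.1 hk] at hj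
  simp only [Finset.sum_singleton] at h1
  refine indepFun_of_dependsOn h1 (dependsOn_sum_summand_div s t c _
    (T := {j : Fin n | ¬ ((j : ℕ) ≤ i ∧ (i : ℕ) ≤ j + 1)}) fun k hk j hj => ?_)
    (Set.disjoint_left.2 fun j h1 h2 => h2 h1)
  simp only [nbhd, Finset.mem_compl, Finset.mem_filter, Finset.mem_univ, true_and] at hk
  simp only [Set.mem_ofPred_eq]
  omega

/-- Summand k uses digits k - 1 and k, so the product uses only digits i - 2, …, i + 1, and summands
at distance at least 3 from i avoid all of these. -/
lemma indepFun_summand_mul_sum (s t c : ℝ) (i : Fin n) :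
    IndepFun (fun ω : LehmerCode n =>
        ω.summand s t i / c * ∑ k ∈ nbhd n 1 i, ω.summand s t k / c)
      (fun ω => ∑ k : Fin n, ω.summand s t k / c - ∑ k ∈ nbhd n 2 i, ω.summand s t k / c)
      (unifCode n) := by
  simp_rw [sum_sub_sum_eq_sum_compl]
  have h1 := dependsOn_sum_summand_div s t c {i}
    (T := {j : Fin n | (j : ℕ) ≤ i + 1 ∧ (i : ℕ) ≤ j + 2}) (by
      simp only [Finset.mem_singleton, forall_eq, Set.mem_ofPred_eq]
      omega)
  have h2 := dependsOn_sum_summand_div s t c (nbhd n 1 i)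
    (T := {j : Fin n | (j : ℕ) ≤ i + 1 ∧ (i : ℕ) ≤ j + 2}) fun k hk j hj => by
      simp only [nbhd, Finset.mem_filter, Finset.mem_univ, true_and] at hk
      simp only [Set.mem_ofPred_eq]
      omega
  simp only [Finset.sum_singleton] at h1
  refine indepFun_of_dependsOn (fun ω ω' h => congrArg₂ (· * ·) (h1 h) (h2 h))
    (dependsOn_sum_summand_div s t c _
      (T := {j : Fin n | ¬ ((j : ℕ) ≤ i + 1 ∧ (i : ℕ) ≤ j + 2)}) fun k hk j hj => ?_)
    (Set.disjoint_left.2 fun j h1 h2 => h2 h1)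
  simp only [nbhd, Finset.mem_compl, Finset.mem_filter, Finset.mem_univ, true_and] at hk
  simp only [Set.mem_ofPred_eq]
  omega

lemma tendsto_integral_sum_sq (s t : ℝ) :
    Tendsto (fun n => ∫ ω : LehmerCode n, (∑ k : Fin n, ω.summand s t k / sigmaInv n) ^ 2
      ∂(unifCode n)) atTop (𝓝 (s ^ 2 + t ^ 2)) := by
  have hlim : Tendsto (fun n : ℕ => (s ^ 2 + t ^ 2) +
      s * t * ((n : ℝ) * (n - 1) / 4 / sigmaInv n ^ 2)) atTop (𝓝 (s ^ 2 + t ^ 2)) := by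
    have h1 : Tendsto (fun n : ℕ => (n : ℝ) * (n - 1) / 4 / sigmaInv n ^ 2) atTop (𝓝 0) := by
      refine squeeze_zero' (g := fun n : ℕ => 9 / (n : ℝ)) ?_ ?_
        (tendsto_const_div_atTop_nhds_zero_nat 9)
      · filter_upwards [eventually_ge_atTop 2] with n hn
        have h : (2 : ℝ) ≤ n := by exact_mod_cast hn
        have : (0 : ℝ) ≤ (n : ℝ) - 1 := by linarith
        positivity
      · filter_upwards [eventually_ge_atTop 2] with n hn
        have h : (2 : ℝ) ≤ n := by exact_mod_cast hn
        rw [div_le_div_iff₀ (pow_pos (sigmaInv_pos hn) 2) (by linarith)]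
        nlinarith [pow_three_le_sigmaInv_sq hn]
    simpa using (h1.const_mul (s * t)).const_add (s ^ 2 + t ^ 2)
  refine hlim.congr' ?_
  filter_upwards [eventually_ge_atTop 2] with n hn
  have hpos := sigmaInv_pos hn
  have h : ∀ ω : LehmerCode n, (∑ k : Fin n, ω.summand s t k / sigmaInv n) ^ 2 =
      (∑ k ∈ Finset.range n, ω.summand s t k) ^ 2 * (1 / sigmaInv n ^ 2) := fun ω => by
    rw [Fin.sum_univ_eq_sum_range fun k => ω.summand s t k / sigmaInv n, ← Finset.sum_div,
      div_pow, div_eq_mul_one_div]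
  simp_rw [h]
  rw [integral_mul_const, integral_sum_summand_sq s t le_rfl, ← sigmaInv_sq hn]
  field_simp

theorem mixedMomentsConverge :
    MixedMomentsConverge unifCode (fun _ => normInv) (fun _ => normMaj) := by
  refine mixedMomentsConverge_of_linear_combination fun s t m => ?_
  simp_rw [linear_combination_eq_sum]
  set K : ℝ := (|s| + |t|) * 6 with hK
  have hK0 : 0 ≤ K := by positivity
  -- Each term is at most K/√n, so n·ε³ = K³/√n tends to 0. A neighbourhood of radius 2 has at most
  -- D = 5 indices.
  refine tendsto_moments_of_local_dependence (ι := fun n => Fin n)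
    (ξ := fun n k ω => summand s t ω k / sigmaInv n) (N₁ := fun n => nbhd n 1)
    (N₂ := fun n => nbhd n 2) (ε := fun n => K / Real.sqrt n) (D := 5)
    (fun n => by positivity) (tendsto_const_div_sqrt K) ?_ ?_
    (fun n i => (card_nbhd_le 1 i).trans (by norm_num)) (fun n i => card_nbhd_le 2 i) ?_
    (fun n i => indepFun_summand s t _ i) (fun n i => indepFun_summand_mul_sum s t _ i)
    (tendsto_integral_sum_sq s t) m
  · refine (tendsto_const_div_sqrt (K ^ 3)).congr fun n => ?_
    rw [Fintype.card_fin]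
    rcases Nat.eq_zero_or_pos n with rfl | hn
    · simp
    · have h0 : (0 : ℝ) < n := by exact_mod_cast hn
      have h1 := Real.sqrt_pos.2 h0
      rw [div_pow, pow_succ (Real.sqrt n), Real.sq_sqrt h0.le]
      field_simp
  · intro n i ω
    have hσ : 0 ≤ sigmaInv n := Real.sqrt_nonneg _
    rw [abs_div, abs_of_nonneg hσ]
    have hi : (i : ℝ) ≤ n := by exact_mod_cast i.2.le
    calc |summand s t ω i| / sigmaInv n ≤ (|s| + |t|) * n / sigmaInv n := by
          gcongr
          exact (abs_summand_le s t ω i).trans (by gcongr)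
      _ = (|s| + |t|) * (n / sigmaInv n) := by ring
      _ ≤ (|s| + |t|) * (6 / Real.sqrt n) :=
          mul_le_mul_of_nonneg_left (div_sigmaInv_le n) (by positivity)
      _ = K / Real.sqrt n := by rw [hK]; ring
  · intro n i
    rw [integral_div, integral_summand s t i.2, zero_div]

end LehmerCode

/-! ### Permutations and their codes -/

namespace LehmerCode

variable {n : ℕ}

/-- The code of a permutation: its digit at `k` is the number of larger entries to the left. -/
def ofPerm (π : Equiv.Perm (Fin n)) : LehmerCode n := fun k =>
  ⟨(Finset.univ.filter fun j => j < k ∧ π k < π j).card, Nat.lt_succ_of_le <| by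
    refine (Finset.card_le_card (t := Finset.Iio k) fun j hj => ?_).trans_eq (Fin.card_Iio k)
    simpa using (Finset.mem_filter.1 hj).2.1⟩

/-- Counting by values instead of positions: a larger value is to the left of k exactly when it is
not used to the right of k. So the digit depends only on π k and the later entries, and decoding
runs from right to left. -/
lemma card_filter_lt_and (π : Equiv.Perm (Fin n)) (k : Fin n) :
    (ofPerm π k : ℕ) =
      (Finset.univ.filter fun v => π k < v ∧ ∀ j, k < j → π j ≠ v).card := by
  change (Finset.univ.filter fun j => j < k ∧ π k < π j).card = _
  refine Finset.card_bij (fun j _ => π j) (fun j hj => ?_) (fun _ _ _ _ h => π.injective h)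
    fun v hv => ?_
  · simp only [Finset.mem_filter, Finset.mem_univ, true_and] at hj ⊢
    exact ⟨hj.2, fun i hi h => by
      rw [π.injective h] at hi
      exact absurd hi (not_lt.2 hj.1.le)⟩
  · simp only [Finset.mem_filter, Finset.mem_univ, true_and] at hv
    refine ⟨π.symm v, ?_, π.apply_symm_apply v⟩
    simp only [Finset.mem_filter, Finset.mem_univ, true_and, Equiv.apply_symm_apply]
    refine ⟨lt_of_le_of_ne (not_lt.1 fun h => hv.2 _ h (π.apply_symm_apply v)) fun h => ?_, hv.1⟩
    rw [← h, Equiv.apply_symm_apply] at hv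
    exact lt_irrefl _ hv.1

/-- With equal entries to the right, a smaller entry at k has strictly more larger unused values: if
π k < τ k, the value τ k itself is counted for π but not for τ. -/
lemma apply_le_of_ofPerm_eq {π τ : Equiv.Perm (Fin n)} {k : Fin n}
    (hk : ofPerm π k = ofPerm τ k) (h : ∀ j, k < j → π j = τ j) : τ k ≤ π k := by
  by_contra! hlt
  have h1 : (Finset.univ.filter fun v => τ k < v ∧ ∀ j, k < j → τ j ≠ v) ⊂
      Finset.univ.filter fun v => π k < v ∧ ∀ j, k < j → π j ≠ v := by
    refine Finset.ssubset_iff_subset_ne.2 ⟨fun v hv => ?_, fun heq => ?_⟩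
    · simp only [Finset.mem_filter, Finset.mem_univ, true_and] at hv ⊢
      exact ⟨hlt.trans hv.1, fun j hj => by rw [h j hj]; exact hv.2 j hj⟩
    · have h2 : τ k ∈ Finset.univ.filter fun v => π k < v ∧ ∀ j, k < j → π j ≠ v := by
        simp only [Finset.mem_filter, Finset.mem_univ, true_and]
        exact ⟨hlt, fun j hj h3 => hj.ne' (τ.injective ((h j hj).symm.trans h3))⟩
      rw [← heq] at h2
      simp at h2
  have h2 := Finset.card_lt_card h1
  rw [← card_filter_lt_and, ← card_filter_lt_and, hk] at h2
  exact lt_irrefl _ h2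

lemma ofPerm_injective : Function.Injective (ofPerm (n := n)) := by
  intro π τ h
  have key : ∀ k, π k = τ k := by
    intro k
    induction k using WellFoundedGT.induction with
    | _ k ih =>
      exact le_antisymm (apply_le_of_ofPerm_eq (congrFun h k).symm fun j hj => (ih j hj).symm)
        (apply_le_of_ofPerm_eq (congrFun h k) ih)
  exact Equiv.ext key

lemma ofPerm_bijective : Function.Bijective (ofPerm (n := n)) := by
  rw [Fintype.bijective_iff_injective_and_card]
  refine ⟨ofPerm_injective, ?_⟩
  rw [Fintype.card_perm, Fintype.card_fin, Fintype.card_pi]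
  simp only [Fintype.card_fin]
  rw [Fin.prod_univ_eq_prod_range fun k => k + 1, Finset.prod_range_add_one_eq_factorial]

lemma digit_ofPerm (π : Equiv.Perm (Fin n)) (k : Fin n) :
    (ofPerm π).digit k = (Finset.univ.filter fun j => j < k ∧ π k < π j).card := by
  simp [digit, ofPerm]

lemma inv_ofPerm (π : Equiv.Perm (Fin n)) : (ofPerm π).inv = invNumber π := by
  rw [inv, ← Fin.sum_univ_eq_sum_range]
  simp_rw [digit_ofPerm, invNumber, Finset.card_filter]
  rw [Fintype.sum_prod_type_right]

/-- At a descent, everything counted at k is counted at k + 1, and so is position k itself. Without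
a descent, everything counted at k + 1 is already counted at k. -/
lemma digit_lt_digit_iff (π : Equiv.Perm (Fin n)) {k : ℕ} (hk : k + 1 < n) :
    (ofPerm π).digit k < (ofPerm π).digit (k + 1) ↔ π ⟨k + 1, hk⟩ < π ⟨k, by omega⟩ := by
  rw [show (ofPerm π).digit k = _ from digit_ofPerm π ⟨k, by omega⟩,
    show (ofPerm π).digit (k + 1) = _ from digit_ofPerm π ⟨k + 1, hk⟩]
  constructor
  · intro h
    by_contra! hle
    refine absurd h (not_lt.2 (Finset.card_le_card fun j hj => ?_))
    simp only [Finset.mem_filter, Finset.mem_univ, true_and, Fin.lt_def] at hj hle ⊢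
    have hne : (j : ℕ) ≠ k := fun h => by
      have : j = ⟨k, by omega⟩ := Fin.ext h
      rw [this] at hj
      exact absurd hj.2 (not_lt.2 hle)
    exact ⟨by omega, lt_of_le_of_lt hle hj.2⟩
  · intro h
    refine Finset.card_lt_card (Finset.ssubset_iff_of_subset (fun j hj => ?_) |>.2
      ⟨⟨k, by omega⟩, ?_, ?_⟩)
    · simp only [Finset.mem_filter, Finset.mem_univ, true_and, Fin.lt_def] at hj h ⊢
      exact ⟨by omega, h.trans hj.2⟩
    · simp only [Finset.mem_filter, Finset.mem_univ, true_and]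
      exact ⟨by simp [Fin.lt_def], h⟩
    · simp

lemma maj_eq_sum (ω : LehmerCode (n + 1)) :
    ω.maj = ∑ k ∈ Finset.range n, (k + 1) * if ω.digit k < ω.digit (k + 1) then 1 else 0 := by
  rw [maj, Finset.sum_range_succ']
  simp

lemma maj_ofPerm (π : Equiv.Perm (Fin n)) : (ofPerm π).maj = majorIndex π := by
  rcases n with _ | n
  · simp [maj, majorIndex]
  · rw [maj_eq_sum, majorIndex, Finset.sum_filter, Fin.sum_univ_castSucc]
    rw [← Fin.sum_univ_eq_sum_range fun k =>
      (k + 1) * if (ofPerm π).digit k < (ofPerm π).digit (k + 1) then 1 else 0]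
    simp only [Fin.val_last, lt_self_iff_false, IsEmpty.exists_iff, if_false, add_zero]
    refine Finset.sum_congr rfl fun k _ => ?_
    have hk : (k : ℕ) + 1 < n + 1 := by omega
    have h1 : (∃ h : ((k.castSucc : Fin (n + 1)) : ℕ) + 1 < n + 1,
        π ⟨((k.castSucc : Fin (n + 1)) : ℕ) + 1, h⟩ < π k.castSucc) ↔
        (ofPerm π).digit k < (ofPerm π).digit (k + 1) := by
      rw [digit_lt_digit_iff π hk]
      exact ⟨fun ⟨_, h⟩ => h, fun h => ⟨hk, h⟩⟩
    simp only [h1, mul_ite, mul_one, mul_zero]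
    rfl

lemma unifCode_eq_uniformOn (n : ℕ) : unifCode n = uniformOn (Set.univ : Set (LehmerCode n)) := by
  refine Measure.ext_of_singleton fun a => ?_
  rw [unifCode, Measure.pi_singleton, uniformOn_univ, Fintype.card_pi]
  simp only [uniformOn_univ, Measure.count_singleton, Fintype.card_fin, Nat.cast_prod]
  rw [ENNReal.prod_div_distrib_of_ne_top (by simp)]
  simp

lemma map_uniformOn_of_bijOn {Ω β : Type} [MeasurableSpace Ω] [Finite Ω]
    [DiscreteMeasurableSpace Ω] [MeasurableSpace β] [Finite β] [DiscreteMeasurableSpace β]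
    {S : Set Ω} {f : Ω → β} (h : Set.BijOn f S Set.univ) :
    (uniformOn S).map f = uniformOn Set.univ := by
  refine Measure.ext_of_singleton fun b => ?_
  obtain ⟨a, haS, rfl⟩ := h.surjOn (Set.mem_univ b)
  have h1 : S ∩ f ⁻¹' {f a} = {a} := by
    ext x
    simp only [Set.mem_inter_iff, Set.mem_preimage, Set.mem_singleton_iff]
    exact ⟨fun hx => h.injOn hx.1 haS hx.2, fun hx => by rw [hx]; exact ⟨haS, rfl⟩⟩
  rw [Measure.map_apply Measurable.of_discrete (measurableSet_singleton _), uniformOn, uniformOn,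
    cond_apply (MeasurableSet.of_discrete), cond_apply MeasurableSet.univ, h1, Set.univ_inter,
    Measure.count_singleton, Measure.count_singleton,
    Measure.count_apply MeasurableSet.of_discrete, Measure.count_apply MeasurableSet.univ,
    ← h.image_eq, h.injOn.encard_image]

lemma map_unifPerm (n : ℕ) : (unifPerm n).map ofPerm = unifCode n := by
  rw [unifCode_eq_uniformOn]
  exact map_uniformOn_of_bijOn (Set.bijOn_univ.2 ofPerm_bijective)

/-! ### Permutations with prescribed last entry -/

/-- The code of a permutation without its last digit. -/
def initOfPerm (π : Equiv.Perm (Fin (n + 1))) : LehmerCode n := fun k => ofPerm π k.castSucc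

lemma digit_initOfPerm (π : Equiv.Perm (Fin (n + 1))) {k : ℕ} (hk : k < n) :
    (initOfPerm π).digit k = (ofPerm π).digit k := by
  simp [digit, initOfPerm, hk, Nat.lt_succ_of_lt hk]

lemma digit_ofPerm_last (π : Equiv.Perm (Fin (n + 1))) :
    (ofPerm π).digit n = n - π (Fin.last n) := by
  have h := card_filter_lt_and π (Fin.last n)
  have h1 : (ofPerm π).digit n = ofPerm π (Fin.last n) := by simp [digit, Fin.last]
  rw [h1, h]
  have h2 : (Finset.univ.filter fun v => π (Fin.last n) < v ∧ ∀ j, Fin.last n < j → π j ≠ v) =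
      Finset.Ioi (π (Fin.last n)) := by
    ext v
    simp only [Finset.mem_filter, Finset.mem_univ, true_and, Finset.mem_Ioi, and_iff_left_iff_imp]
    exact fun _ j hj => absurd hj (not_lt.2 (Fin.le_last j))
  rw [h2, Fin.card_Ioi]
  omega

lemma ext_digit {ω ω' : LehmerCode n} (h : ∀ k < n, ω.digit k = ω'.digit k) : ω = ω' := by
  funext k
  have := h k k.2
  simpa [digit, Fin.ext_iff] using this

/-- Prescribing the last entry is the same as prescribing the last digit, and the other digits
remain free. -/
lemma bijOn_initOfPerm (i : Fin (n + 1)) :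
    Set.BijOn initOfPerm {π : Equiv.Perm (Fin (n + 1)) | π (Fin.last n) = i} Set.univ := by
  refine ⟨Set.mapsTo_univ _ _, fun π hπ τ hτ h => ofPerm_injective (ext_digit fun k hk => ?_),
    fun ω _ => ?_⟩
  · rcases Nat.lt_succ_iff_lt_or_eq.1 hk with hk | rfl
    · rw [← digit_initOfPerm π hk, h, digit_initOfPerm τ hk]
    · rw [digit_ofPerm_last, digit_ofPerm_last, show π _ = i from hπ, show τ _ = i from hτ]
  · obtain ⟨π, hπ⟩ := ofPerm_bijective.2
      (fun k : Fin (n + 1) => if h : (k : ℕ) < n then ω ⟨k, h⟩ else ⟨k - i, by omega⟩)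
    refine ⟨π, ?_, ?_⟩
    · have h1 := digit_ofPerm_last π
      rw [hπ] at h1
      simp only [digit, Nat.lt_succ_self, dite_true, lt_self_iff_false, dite_false] at h1
      refine Fin.ext ?_
      have := (π (Fin.last n)).2
      have := i.2
      omega
    · funext k
      rw [initOfPerm, hπ]
      simp

/-- The law of the first n digits does not depend on i, which is why the last entry may vary
arbitrarily with n. -/
lemma map_unifPermEnding (i : Fin (n + 1)) :
    (unifPermEnding n i).map initOfPerm = unifCode n := by
  rw [unifCode_eq_uniformOn]
  exact map_uniformOn_of_bijOn (bijOn_initOfPerm i)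

lemma invNumber_eq (π : Equiv.Perm (Fin (n + 1))) :
    invNumber π = (initOfPerm π).inv + (n - π (Fin.last n)) := by
  rw [← inv_ofPerm, inv, Finset.sum_range_succ, digit_ofPerm_last, inv]
  congr 1
  exact Finset.sum_congr rfl fun k hk => (digit_initOfPerm π (Finset.mem_range.1 hk)).symm

lemma majorIndex_eq (π : Equiv.Perm (Fin (n + 1))) :
    majorIndex π = (initOfPerm π).maj +
      n * if (ofPerm π).digit (n - 1) < (ofPerm π).digit n then 1 else 0 := by
  rw [← maj_ofPerm, maj, Finset.sum_range_succ, maj]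
  congr 1
  refine Finset.sum_congr rfl fun k hk => ?_
  have hk := Finset.mem_range.1 hk
  rw [digit_initOfPerm π hk, digit_initOfPerm π (by omega)]

lemma mixedMomentsConverge_comp {Ω : ℕ → Type} [∀ n, MeasurableSpace (Ω n)]
    [∀ n, DiscreteMeasurableSpace (Ω n)] {P : ∀ n, Measure (Ω n)} {c : ∀ n, Ω n → LehmerCode n}
    (h : ∀ n, (P n).map (c n) = unifCode n) :
    MixedMomentsConverge P (fun n ω => (c n ω).normInv) (fun n ω => (c n ω).normMaj) := by
  intro a b
  refine (mixedMomentsConverge a b).congr fun n => ?_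
  rw [← h n, integral_map Measurable.of_discrete.aemeasurable
    Measurable.of_discrete.aestronglyMeasurable]

end LehmerCode

/-! ### Transfer to permutations -/

lemma mixedMomentsConverge_unifPerm : MixedMomentsConverge unifPerm normInv normMaj := by
  have h := LehmerCode.mixedMomentsConverge_comp LehmerCode.map_unifPerm
  simp only [LehmerCode.normInv, LehmerCode.normMaj, LehmerCode.inv_ofPerm,
    LehmerCode.maj_ofPerm] at h
  exact h

/-- Here σ_{n+1}² - σ_n² = n(n+2)/12 ≤ (n+1)², and 1 - σ_n/σ_{n+1} ≤ (σ_{n+1}² - σ_n²)/σ_{n+1}². -/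
lemma abs_sigmaInv_div_succ_sub_one_le {n : ℕ} (hn : 2 ≤ n) :
    |sigmaInv n / sigmaInv (n + 1) - 1| ≤ (6 / Real.sqrt ((n + 1 : ℕ) : ℝ)) ^ 2 := by
  have h0 := sigmaInv_pos hn
  have h1 := sigmaInv_pos (show 2 ≤ n + 1 by omega)
  have hsq : sigmaInv (n + 1) ^ 2 - sigmaInv n ^ 2 = n * (n + 2) / 12 := by
    rw [sigmaInv_sq hn, sigmaInv_sq (show 2 ≤ n + 1 by omega)]
    push_cast
    ring
  have hn0 : (0 : ℝ) ≤ n := by positivity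
  have hle : sigmaInv n ≤ sigmaInv (n + 1) :=
    (sq_le_sq₀ h0.le h1.le).1 (sub_nonneg.1 (by rw [hsq]; positivity))
  have h2 : (((n + 1 : ℕ) : ℝ) / sigmaInv (n + 1)) ^ 2 ≤
      (6 / Real.sqrt ((n + 1 : ℕ) : ℝ)) ^ 2 :=
    pow_le_pow_left₀ (by positivity) (div_sigmaInv_le (n + 1)) 2
  refine le_trans ?_ h2
  rw [abs_of_nonpos (by rw [sub_nonpos]; exact (div_le_one h1).2 hle), neg_sub, div_pow,
    one_sub_div h1.ne', div_le_div_iff₀ h1 (by positivity)]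
  have h3 : (sigmaInv (n + 1) - sigmaInv n) * sigmaInv (n + 1) ≤ ((n + 1 : ℕ) : ℝ) ^ 2 := by
    push_cast
    nlinarith
  nlinarith

/-- The centering grows by n/2, so the last digit's contribution d shifts the numerator by at most
n/2, which is O(√n)-fold smaller than σ_{n+1}; the rest is the change of scale. -/
lemma abs_normalize_add_sub_le {n : ℕ} (hn : 2 ≤ n) {x d : ℝ} (hd0 : 0 ≤ d) (hdn : d ≤ n) :
    |(x + d - meanInv (n + 1)) / sigmaInv (n + 1) - (x - meanInv n) / sigmaInv n| ≤
      ((6 / Real.sqrt ((n + 1 : ℕ) : ℝ)) ^ 2 + 6 / Real.sqrt ((n + 1 : ℕ) : ℝ)) *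
        (1 + |(x - meanInv n) / sigmaInv n|) := by
  have h0 := sigmaInv_pos hn
  have h1 := sigmaInv_pos (show 2 ≤ n + 1 by omega)
  have hm : meanInv (n + 1) = meanInv n + n / 2 := by
    rw [meanInv, meanInv]
    push_cast
    ring
  set X := (x - meanInv n) / sigmaInv n with hX
  set u := 6 / Real.sqrt ((n + 1 : ℕ) : ℝ) with hu
  have hu0 : 0 ≤ u := by positivity
  have h2 : |(d - n / 2) / sigmaInv (n + 1)| ≤ u := by
    rw [abs_div, abs_of_pos h1]
    refine le_trans ?_ (div_sigmaInv_le (n + 1))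
    gcongr
    push_cast
    rw [abs_le]
    constructor <;> linarith
  have h3 : (x + d - meanInv (n + 1)) / sigmaInv (n + 1) - X =
      (sigmaInv n / sigmaInv (n + 1) - 1) * X + (d - n / 2) / sigmaInv (n + 1) := by
    rw [hm, hX]
    field_simp
    ring
  rw [h3]
  calc _ ≤ |sigmaInv n / sigmaInv (n + 1) - 1| * |X| + |(d - n / 2) / sigmaInv (n + 1)| := by
        refine (abs_add_le _ _).trans_eq ?_
        rw [abs_mul]
    _ ≤ u ^ 2 * |X| + u := by
        gcongr
        exact abs_sigmaInv_div_succ_sub_one_le hn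
    _ ≤ (u ^ 2 + u) * (1 + |X|) := by
        have h4 := mul_nonneg hu0 (abs_nonneg X)
        nlinarith [sq_nonneg u]

lemma mixedMomentsConverge_unifPermEnding (i : (n : ℕ) → Fin (n + 1)) :
    MixedMomentsConverge (fun n => unifPermEnding n (i n))
      (fun n => normInv (n + 1)) (fun n => normMaj (n + 1)) := by
  have h := LehmerCode.mixedMomentsConverge_comp fun n => LehmerCode.map_unifPermEnding (i n)
  have hu : Tendsto (fun n : ℕ => 6 / Real.sqrt ((n + 1 : ℕ) : ℝ)) atTop (𝓝 0) :=
    (tendsto_const_div_sqrt 6).comp (tendsto_add_atTop_nat 1)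
  refine h.of_perturbation
    (ε := fun n => (6 / Real.sqrt ((n + 1 : ℕ) : ℝ)) ^ 2 + 6 / Real.sqrt ((n + 1 : ℕ) : ℝ))
    (fun n => by positivity) (by simpa using (hu.pow 2).add hu) ?_ ?_
  · filter_upwards [eventually_ge_atTop 2] with n hn π
    have h1 := abs_normalize_add_sub_le hn (x := (LehmerCode.initOfPerm π).inv)
      (d := ((n - π (Fin.last n) : ℕ) : ℝ)) (by positivity)
      (by exact_mod_cast Nat.sub_le _ _)
    rw [normInv, LehmerCode.invNumber_eq, LehmerCode.normInv]
    push_cast at h1 ⊢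
    refine h1.trans (mul_le_mul_of_nonneg_left ?_ (by positivity))
    linarith [abs_nonneg ((LehmerCode.initOfPerm π).normMaj)]
  · filter_upwards [eventually_ge_atTop 2] with n hn π
    have h1 := abs_normalize_add_sub_le hn (x := (LehmerCode.initOfPerm π).maj)
      (d := n * if (LehmerCode.ofPerm π).digit (n - 1) < (LehmerCode.ofPerm π).digit n
        then 1 else 0) (by split_ifs <;> simp) (by split_ifs <;> simp)
    rw [normMaj, LehmerCode.majorIndex_eq, LehmerCode.normMaj]
    push_cast at h1 ⊢
    refine h1.trans (mul_le_mul_of_nonneg_left ?_ (by positivity))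
    linarith [abs_nonneg ((LehmerCode.initOfPerm π).normInv)]

/-! ### Standardization by the true mean and deviation -/

/-- Invariance under affine maps reduces the raw statistics to the normalized ones, whose moments
are known. -/
lemma standardize_eq_of_affine {Ω : Type} [MeasurableSpace Ω] [Finite Ω]
    [DiscreteMeasurableSpace Ω] (P : Measure Ω) [IsProbabilityMeasure P] (f : Ω → ℝ)
    {m σ : ℝ} (hσ : 0 < σ) :
    standardize P f = standardize P fun ω => (f ω - m) / σ := by
  have hE : ∫ ω, (f ω - m) / σ ∂P = ((∫ ω, f ω ∂P) - m) / σ := by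
    rw [integral_div, integral_sub Integrable.of_finite Integrable.of_finite]
    simp
  have hV : variance (fun ω => (f ω - m) / σ) P = variance f P / σ ^ 2 := by
    rw [variance_eq_integral Measurable.of_discrete.aemeasurable,
      variance_eq_integral Measurable.of_discrete.aemeasurable, hE, ← integral_div]
    refine integral_congr_ae (ae_of_all _ fun ω => ?_)
    simp only
    rw [← div_pow]
    ring
  funext ω
  rw [standardize, standardize, hE, hV, Real.sqrt_div' _ (by positivity), Real.sqrt_sq hσ.le,
    ← sub_div, sub_sub_sub_cancel_right, div_div_div_cancel_right₀ hσ.ne']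

/-- A bound for the relative change of `X` under standardization. -/
def standardizeError {Ω : Type} [MeasurableSpace Ω] (P : Measure Ω) (X : Ω → ℝ) : ℝ :=
  |(Real.sqrt (variance X P))⁻¹ - 1| + |(∫ ω, X ω ∂P) * (Real.sqrt (variance X P))⁻¹|

lemma standardizeError_nonneg {Ω : Type} [MeasurableSpace Ω] (P : Measure Ω) (X : Ω → ℝ) :
    0 ≤ standardizeError P X :=
  add_nonneg (abs_nonneg _) (abs_nonneg _)

lemma abs_standardize_sub_le {Ω : Type} [MeasurableSpace Ω] (P : Measure Ω) (X : Ω → ℝ) (ω : Ω) :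
    |standardize P X ω - X ω| ≤ standardizeError P X * (1 + |X ω|) := by
  unfold standardizeError
  set τ := (Real.sqrt (variance X P))⁻¹ with hτ
  have h : standardize P X ω - X ω = (τ - 1) * X ω - (∫ ω, X ω ∂P) * τ := by
    rw [standardize, div_eq_mul_inv, ← hτ]
    ring
  rw [h]
  refine (abs_sub _ _).trans ?_
  rw [abs_mul (τ - 1)]
  nlinarith [mul_nonneg (abs_nonneg ((∫ ω, X ω ∂P) * τ)) (abs_nonneg (X ω)),
    abs_nonneg (τ - 1)]

lemma tendsto_standardize_error {Ω : ℕ → Type} [∀ n, MeasurableSpace (Ω n)]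
    [∀ n, Finite (Ω n)] [∀ n, DiscreteMeasurableSpace (Ω n)] {P : ∀ n, Measure (Ω n)}
    [∀ n, IsProbabilityMeasure (P n)] {X : ∀ n, Ω n → ℝ}
    (h1 : Tendsto (fun n => ∫ ω, X n ω ∂(P n)) atTop (𝓝 0))
    (h2 : Tendsto (fun n => ∫ ω, X n ω ^ 2 ∂(P n)) atTop (𝓝 1)) :
    Tendsto (fun n => standardizeError (P n) (X n)) atTop (𝓝 0) := by
  have hV : Tendsto (fun n => variance (X n) (P n)) atTop (𝓝 1) := by
    have h : ∀ n, variance (X n) (P n) = ∫ ω, X n ω ^ 2 ∂(P n) - (∫ ω, X n ω ∂(P n)) ^ 2 :=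
      fun n => variance_eq_sub MemLp.of_discrete
    simp_rw [h]
    simpa using h2.sub (h1.pow 2)
  have hτ : Tendsto (fun n => (Real.sqrt (variance (X n) (P n)))⁻¹) atTop (𝓝 1) := by
    simpa using ((Real.continuous_sqrt.tendsto 1).comp hV).inv₀ (by simp)
  have h := (hτ.sub_const 1).abs.add (h1.mul hτ).abs
  simp only [sub_self, abs_zero, zero_mul, add_zero] at h
  exact h

/-- Convergence of the first two moments makes the mean tend to 0 and the deviation to 1, so
standardizing is a small perturbation. -/
lemma MixedMomentsConverge.standardized {Ω : ℕ → Type} [∀ n, MeasurableSpace (Ω n)]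
    [∀ n, Finite (Ω n)] [∀ n, DiscreteMeasurableSpace (Ω n)] {P : ∀ n, Measure (Ω n)}
    [∀ n, IsProbabilityMeasure (P n)] {X Y : ∀ n, Ω n → ℝ} (h : MixedMomentsConverge P X Y) :
    MixedMomentsConverge P (fun n => standardize (P n) (X n))
      (fun n => standardize (P n) (Y n)) := by
  have hX := tendsto_standardize_error (P := P) (X := X)
    (by simpa [gaussMoment] using h 1 0) (by simpa [gaussMoment] using h 2 0)
  have hY := tendsto_standardize_error (P := P) (X := Y)
    (by simpa [gaussMoment] using h 0 1) (by simpa [gaussMoment] using h 0 2)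
  refine h.of_perturbation
    (ε := fun n => standardizeError (P n) (X n) + standardizeError (P n) (Y n))
    (fun n => add_nonneg (standardizeError_nonneg _ _) (standardizeError_nonneg _ _))
    (by simpa using hX.add hY) ?_ ?_
  · refine Eventually.of_forall fun n ω => (abs_standardize_sub_le (P n) (X n) ω).trans ?_
    exact mul_le_mul (le_add_of_nonneg_right (standardizeError_nonneg _ _))
      (le_add_of_nonneg_right (abs_nonneg _)) (by positivity)
      (add_nonneg (standardizeError_nonneg _ _) (standardizeError_nonneg _ _))
  · refine Eventually.of_forall fun n ω => (abs_standardize_sub_le (P n) (Y n) ω).trans ?_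
    exact mul_le_mul (le_add_of_nonneg_left (standardizeError_nonneg _ _))
      (by linarith [abs_nonneg (X n ω)]) (by positivity)
      (add_nonneg (standardizeError_nonneg _ _) (standardizeError_nonneg _ _))

lemma mixedMomentsConverge_standardize_unifPermEnding (i : (n : ℕ) → Fin (n + 1)) :
    MixedMomentsConverge (fun n => unifPermEnding n (i n))
      (fun n => standardize (unifPermEnding n (i n))
        (fun π : Equiv.Perm (Fin (n + 1)) => (invNumber π : ℝ)))
      (fun n => standardize (unifPermEnding n (i n))
        (fun π : Equiv.Perm (Fin (n + 1)) => (majorIndex π : ℝ))) := by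
  intro a b
  refine ((mixedMomentsConverge_unifPermEnding i).standardized a b).congr' ?_
  -- From n = 1 on there are at least two entries, so σ_{n+1} > 0 and the affine map is legitimate.
  filter_upwards [eventually_ge_atTop 1] with n hn
  have hσ := sigmaInv_pos (show 2 ≤ n + 1 by omega)
  rw [standardize_eq_of_affine _ (fun π : Equiv.Perm (Fin (n + 1)) => (invNumber π : ℝ))
      (m := meanInv (n + 1)) hσ,
    standardize_eq_of_affine _ (fun π : Equiv.Perm (Fin (n + 1)) => (majorIndex π : ℝ))
      (m := meanInv (n + 1)) hσ]
  rfl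

theorem mainTheorem1 :
    AsympJointIndepNormal unifPerm normInv normMaj ∧
    ∀ i : (n : ℕ) → Fin (n + 1),
      AsympJointIndepNormal (fun n => unifPermEnding n (i n))
        (fun n => normInv (n + 1)) (fun n => normMaj (n + 1)) ∧
      AsympJointIndepNormal (fun n => unifPermEnding n (i n))
        (fun n => standardize (unifPermEnding n (i n))
          (fun π : Equiv.Perm (Fin (n + 1)) => (invNumber π : ℝ)))
        (fun n => standardize (unifPermEnding n (i n))
          (fun π : Equiv.Perm (Fin (n + 1)) => (majorIndex π : ℝ))) :=
  ⟨mixedMomentsConverge_unifPerm.asympJointIndepNormal, fun i =>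
    ⟨(mixedMomentsConverge_unifPermEnding i).asympJointIndepNormal,
      (mixedMomentsConverge_standardize_unifPermEnding i).asympJointIndepNormal⟩⟩

end
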